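/- Lemma 2.2. Let $M$ be a finite von Neumann algebra with a faithful, normal, normalized trace $\tau$, let $L^2(M,\tau)$ be its GNS space with canonical vector $\xi_\tau$, and let $\alpha$ be a $\tau$-preserving action of a countable group $\Gamma$ on $M$; write also $\alpha_g$ for the unitary of $L^2(M,\tau)$ extending $x\xi_\tau\mapsto\alpha_g(x)\xi_\tau$. Assume that: (a) $\alpha$ is s-strongly ergodic: for every sequence of unit vectors $\xi_n\in L^2(M,\tau)$ with $\|\alpha_g(\xi_n)-\xi_n\|\to 0$ for all $g\in\Gamma$, one has $\|\xi_n-\langle\xi_n,\xi_\tau\rangle\xi_\tau\|\to 0$; (b) $\alpha$ is free: for every $g\neq 1$, $\alpha_g$ is properly outer, i.e. the only $a\in M$ with $ax=\alpha_g(x)a$ for all $x\in M$ is $a=0$; (c) with $Z=Z(\Gamma)$ the center of $\Gamma$, the group $\Gamma/Z$ is nontrivial and not inner amenable, i.e. there is no finitely additive conjugation-invariant probability measure on the subsets of $\Gamma/Z$ that vanishes on $\{1\}$. Let $N=M\rtimes_\alpha\Gamma$ be the crossed product, generated by $M$ and the unitaries $\lambda(g)$, $g\in\Gamma$, acting on $L^2(M,\tau)\otimes\ell^2(\Gamma)$,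 with the extended trace $\tau=\langle\,\cdot\,(\xi_\tau\otimes\delta_1),\xi_\tau\otimes\delta_1\rangle$ and $\|x\|_2=\tau(x^*x)^{1/2}$. A central sequence of $N$ is an operator-norm bounded sequence $(x_n)$ in $N$ with $\|x_nx-xx_n\|_2\to0$ for all $x\in N$; two bounded sequences are equivalent if $\|x_n-y_n\|_2\to 0$. Then $N$ is a factor of type $II_1$, and every central sequence in $N$ is equivalent to a central sequence $(c_n)$ contained in $L(Z)$ (the von Neumann algebra generated by the $\lambda(z)$, $z\in Z$) such that, with $c_n(z)=\tau(c_n\lambda(z^{-1}))$, for every finite subset $K$ of $Z\setminus\{1\}$ $$\lim_{n\to\infty}\sum_{z\in K}|c_n(z)|^2=0.$$ In particular, if $Z$ is finite, then $N$ is a full $II_1$ factor, i.e. moreover every central sequence $(x_n)$ in $N$ is equivalent to the scalar sequence $(\tau(x_n))$. -/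

import Mathlib

open Filter Topology
open scoped ComplexOrder

universe u v

/-! ### A von Neumann algebra as an ordered C*-algebra

These instances allow Mathlib's positive functionals and GNS construction to be used on a
von Neumann algebra. The order is the usual order of operators. -/

section VNInstances

variable {H : Type u} [NormedAddCommGroup H] [InnerProductSpace ℂ H] [CompleteSpace H]

instance VonNeumannAlgebra.instSMulMemClass :
    SMulMemClass (VonNeumannAlgebra H) ℂ (H →L[ℂ] H) where
  smul_mem {s} c _ hx := s.toStarSubalgebra.smul_mem hx c

instance VonNeumannAlgebra.instIsClosed (M : VonNeumannAlgebra H) :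
    IsClosed (M : Set (H →L[ℂ] H)) := by
  rw [← M.centralizer_centralizer]
  exact Set.isClosed_centralizer _

theorem VonNeumannAlgebra.sqrt_mem (M : VonNeumannAlgebra H) {a : H →L[ℂ] H} (ha : a ∈ M) :
    CFC.sqrt a ∈ M := by
  rw [← M.commutant_commutant, VonNeumannAlgebra.mem_commutant_iff]
  intro g hg
  have h : Commute a g := (VonNeumannAlgebra.mem_commutant_iff.1 hg) a ha
  have h2 : Commute (CFC.sqrt a) g := h.cfcₙ_nnreal _
  exact h2.eq.symm

instance VonNeumannAlgebra.instStarOrderedRing (M : VonNeumannAlgebra H) :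
    StarOrderedRing M := by
  refine StarOrderedRing.of_le_iff fun x y => ⟨fun hxy => ?_, ?_⟩
  · have hnn : (0 : H →L[ℂ] H) ≤ (y : H →L[ℂ] H) - x := sub_nonneg.2 hxy
    refine ⟨⟨CFC.sqrt ((y : H →L[ℂ] H) - x), M.sqrt_mem (sub_mem y.2 x.2)⟩, ?_⟩
    apply Subtype.ext
    change (y : H →L[ℂ] H) = x + star (CFC.sqrt ((y : H →L[ℂ] H) - x)) *
      CFC.sqrt ((y : H →L[ℂ] H) - x)
    rw [(CFC.sqrt_nonneg _).isSelfAdjoint.star_eq, CFC.sqrt_mul_sqrt_self _ hnn]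
    abel
  · rintro ⟨s, rfl⟩
    change (x : H →L[ℂ] H) ≤ x + star (s : H →L[ℂ] H) * s
    exact le_add_of_nonneg_right (star_mul_self_nonneg _)

/-- The von Neumann algebra `(S ∪ S*)''` generated by a set `S` of bounded operators. -/
noncomputable def VonNeumannAlgebra.generatedBy (S : Set (H →L[ℂ] H)) : VonNeumannAlgebra H where
  toStarSubalgebra :=
    StarSubalgebra.centralizer ℂ (StarSubalgebra.centralizer ℂ S : Set (H →L[ℂ] H))
  centralizer_centralizer' := by
    have h : ((StarSubalgebra.centralizer ℂ
        (StarSubalgebra.centralizer ℂ S : Set (H →L[ℂ] H))) : Set (H →L[ℂ] H)) =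
        Set.centralizer (Set.centralizer (S ∪ star S)) := by
      rw [StarSubalgebra.coe_centralizer_centralizer]
    change Set.centralizer (Set.centralizer ((StarSubalgebra.centralizer ℂ
        (StarSubalgebra.centralizer ℂ S : Set (H →L[ℂ] H))) : Set (H →L[ℂ] H))) =
      ((StarSubalgebra.centralizer ℂ
        (StarSubalgebra.centralizer ℂ S : Set (H →L[ℂ] H))) : Set (H →L[ℂ] H))
    rw [h]
    simp

end VNInstances

namespace VNCrossed

section Trace

variable {H : Type u} [NormedAddCommGroup H] [InnerProductSpace ℂ H] [CompleteSpace H]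

/-- `τ` is a normal, faithful, normalized trace on `M`; normality is ultraweak continuity, i.e.
`τ` belongs to the predual of `M`. -/
structure IsTrace (M : VonNeumannAlgebra H) (τ : M →ₚ[ℂ] ℂ) : Prop where
  map_one : τ 1 = 1
  map_mul_comm : ∀ x y : M, τ (x * y) = τ (y * x)
  faithful : ∀ x : M, τ (star x * x) = 0 → x = 0
  normal : ∃ ξ η : ℕ → H, Summable (fun i => ‖ξ i‖ ^ 2) ∧ Summable (fun i => ‖η i‖ ^ 2) ∧
    ∀ x : M, HasSum (fun i => inner ℂ (ξ i) ((x : H →L[ℂ] H) (η i))) (τ x)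

variable {M : VonNeumannAlgebra H} (τ : M →ₚ[ℂ] ℂ)

/-- The canonical vector `ξ_τ` of `L²(M, τ)` (the GNS space of `τ`): the class of `1`. -/
noncomputable def traceVector : τ.GNS := ((τ.toPreGNS 1 : τ.PreGNS) : τ.GNS)

variable {Γ : Type v} [Group Γ] (α : Γ →* (M ≃⋆ₐ[ℂ] M))

/-- The action `α` preserves `τ`. -/
def PreservesTrace : Prop := ∀ (g : Γ) (x : M), τ (α g x) = τ x

variable {τ α}

/-- The operator `α_g` on `L²(M, τ)`, the extension of `x ξ_τ ↦ α_g(x) ξ_τ`. -/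
noncomputable def koopman (hα : PreservesTrace τ α) (g : Γ) : τ.GNS →L[ℂ] τ.GNS :=
  (LinearMap.mkContinuous
    (τ.toPreGNS.toLinearMap ∘ₗ (α g).toAlgEquiv.toLinearMap ∘ₗ τ.ofPreGNS.toLinearMap :
      τ.PreGNS →ₗ[ℂ] τ.PreGNS) 1 (fun x => by
      have h : τ (star (α g (τ.ofPreGNS x)) * α g (τ.ofPreGNS x)) =
          τ (star (τ.ofPreGNS x) * τ.ofPreGNS x) := by
        rw [← map_star, ← map_mul, hα]
      rw [one_mul, PositiveLinearMap.preGNS_norm_def, PositiveLinearMap.preGNS_norm_def]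
      exact le_of_eq (congrArg (fun z : ℂ => Real.sqrt z.re) h))).completion

/-- s-strong ergodicity: every sequence of almost invariant unit vectors in `L²(M, τ)` is
asymptotically proportional to `ξ_τ`. -/
def IsSStronglyErgodic (hα : PreservesTrace τ α) : Prop :=
  ∀ ξ : ℕ → τ.GNS, (∀ n, ‖ξ n‖ = 1) →
    (∀ g : Γ, Tendsto (fun n => ‖koopman hα g (ξ n) - ξ n‖) atTop (𝓝 0)) →
    Tendsto (fun n => ‖ξ n - (inner ℂ (traceVector τ) (ξ n) : ℂ) • traceVector τ‖) atTop (𝓝 0)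

variable (α) in
/-- The action is free: for `g ≠ 1` the automorphism `α_g` is properly outer, that is, `0` is the
only `a ∈ M` with `a x = α_g(x) a` for all `x ∈ M`. -/
def IsFreeAction : Prop :=
  ∀ g : Γ, g ≠ 1 → ∀ a : M, (∀ x : M, a * x = α g x * a) → a = 0

end Trace

/-- `G` is inner amenable: there is a finitely additive, conjugation-invariant probability measure
on all subsets of `G` which gives mass zero to `{1}` (equivalently, a conjugation-invariant mean
on `G \ {1}`). -/
def IsInnerAmenable (G : Type v) [Group G] : Prop :=
  ∃ m : Set G → ℝ, (∀ A, 0 ≤ m A) ∧ m Set.univ = 1 ∧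
    (∀ A B, Disjoint A B → m (A ∪ B) = m A + m B) ∧
    m {1} = 0 ∧ ∀ (g : G) (A : Set G), m ((fun h => g * h * g⁻¹) '' A) = m A

/-! ### The crossed product, acting on `L²(M, τ) ⊗ ℓ²(Γ) = ℓ²(Γ, L²(M, τ))` -/

section Operators

variable {Γ : Type v} {E : Type u} [NormedAddCommGroup E]

/-- The Hilbert space `E ⊗ ℓ²(Γ)`, realized as `ℓ²(Γ, E)`. -/
abbrev L2 (Γ : Type v) (E : Type u) [NormedAddCommGroup E] : Type (max u v) :=
  lp (fun _ : Γ => E) 2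

theorem norm_sq_eq_tsum (f : L2 Γ E) : ‖f‖ ^ 2 = ∑' g, ‖f g‖ ^ 2 := by
  have := lp.norm_rpow_eq_tsum (p := 2) (by norm_num) f
  simpa using this

theorem summable_norm_sq (f : L2 Γ E) : Summable fun g => ‖f g‖ ^ 2 := by
  have := (lp.memℓp f).summable (by norm_num)
  simpa using this

theorem memlp_two {f : Γ → E} (h : Summable fun g => ‖f g‖ ^ 2) :
    Memℓp f 2 := by
  apply memℓp_gen
  simpa using h

variable [InnerProductSpace ℂ E]

theorem diag_bound {T : Γ → E →L[ℂ] E} {C : ℝ} (hT : ∀ g, ‖T g‖ ≤ C) (f : L2 Γ E) (g : Γ) :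
    ‖T g (f g)‖ ^ 2 ≤ C ^ 2 * ‖f g‖ ^ 2 := by
  rw [← mul_pow]
  exact pow_le_pow_left₀ (norm_nonneg _) ((T g).le_of_opNorm_le (hT g) _) 2

/-- The diagonal operator `(T ξ)(g) = T_g (ξ g)` of a bounded family `(T_g)`. -/
noncomputable def diagOp (T : Γ → E →L[ℂ] E) (C : ℝ) (hC : 0 ≤ C) (hT : ∀ g, ‖T g‖ ≤ C) :
    L2 Γ E →L[ℂ] L2 Γ E :=
  LinearMap.mkContinuous
    { toFun := fun f => ⟨fun g => T g (f g), memlp_two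
        (Summable.of_nonneg_of_le (fun _ => sq_nonneg _) (diag_bound hT f)
          ((summable_norm_sq f).mul_left _))⟩
      map_add' := fun f f' => by ext g; exact map_add (T g) _ _
      map_smul' := fun c f => by ext g; simp } C (fun f => by
    refine le_of_sq_le_sq ?_ (mul_nonneg hC (norm_nonneg _))
    rw [mul_pow, norm_sq_eq_tsum, norm_sq_eq_tsum, ← tsum_mul_left]
    exact Summable.tsum_le_tsum (diag_bound hT f)
      (Summable.of_nonneg_of_le (fun _ => sq_nonneg _) (diag_bound hT f)
          ((summable_norm_sq f).mul_left _)) ((summable_norm_sq f).mul_left _))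

variable [Group Γ]

/-- The left translation operator `λ(g) = 1 ⊗ λ_g`, `(λ(g) ξ)(h) = ξ(g⁻¹ h)`. -/
noncomputable def lam (E : Type u) [NormedAddCommGroup E] [InnerProductSpace ℂ E] (g : Γ) :
    L2 Γ E →L[ℂ] L2 Γ E :=
  LinearMap.mkContinuous
    { toFun := fun f => ⟨fun h => f (g⁻¹ * h), memlp_two
        ((Equiv.mulLeft g⁻¹).summable_iff.2 (summable_norm_sq f))⟩
      map_add' := fun f f' => by ext h; rfl
      map_smul' := fun c f => by ext h; simp } 1 (fun f => by
    rw [one_mul]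
    refine le_of_sq_le_sq ?_ (norm_nonneg _)
    rw [norm_sq_eq_tsum, norm_sq_eq_tsum]
    exact le_of_eq ((Equiv.mulLeft g⁻¹).tsum_eq fun h => ‖f h‖ ^ 2))

end Operators

section CrossedProduct

variable {H : Type u} [NormedAddCommGroup H] [InnerProductSpace ℂ H] [CompleteSpace H]
  {M : VonNeumannAlgebra H} (τ : M →ₚ[ℂ] ℂ) {Γ : Type v} [Group Γ] (α : Γ →* (M ≃⋆ₐ[ℂ] M))

/-- The operator by which `x ∈ M` acts: `(x · ξ)(g) = α_{g⁻¹}(x) ξ(g)`, where `M` acts on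
`L²(M, τ)` by the GNS representation. -/
noncomputable def embed (x : M) : L2 Γ τ.GNS →L[ℂ] L2 Γ τ.GNS :=
  diagOp (fun g => τ.gnsStarAlgHom (α g⁻¹ x)) ‖x‖ (norm_nonneg _) (fun g =>
    (NonUnitalStarAlgHom.norm_apply_le τ.gnsStarAlgHom _).trans
      (NonUnitalStarAlgHom.norm_apply_le (α g⁻¹) x))

/-- The crossed product `M ⋊_α Γ`, generated by `M` and the `λ(g)`, `g ∈ Γ`. -/
noncomputable def crossedProduct : VonNeumannAlgebra (L2 Γ τ.GNS) :=
  VonNeumannAlgebra.generatedBy (Set.range (embed τ α) ∪ Set.range (lam (Γ := Γ) τ.GNS))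

/-- The copy of `L(Λ)` in the crossed product, generated by the `λ(g)`, `g ∈ Λ`. -/
noncomputable def groupAlgebra (Λ : Subgroup Γ) : VonNeumannAlgebra (L2 Γ τ.GNS) :=
  VonNeumannAlgebra.generatedBy (lam τ.GNS '' (Λ : Set Γ))

variable (Γ) in
open Classical in
/-- The vector `ξ_τ ⊗ δ_1`, which implements the extended trace of the crossed product. -/
noncomputable def cpVector : L2 Γ τ.GNS := lp.single 2 (1 : Γ) (traceVector τ)

end CrossedProduct

/-! ### Factors, central sequences, fullness -/

section Factors

variable {K : Type u} [NormedAddCommGroup K] [InnerProductSpace ℂ K]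

/-- The functional `⟨x Ω, Ω⟩` (the trace, when `Ω` is the canonical trace vector). -/
noncomputable def vecState (Ω : K) (x : K →L[ℂ] K) : ℂ := inner ℂ Ω (x Ω)

/-- The norm `‖x‖₂ = ⟨x* x Ω, Ω⟩^(1/2) = ‖x Ω‖`. -/
noncomputable def norm2 (Ω : K) (x : K →L[ℂ] K) : ℝ := ‖x Ω‖

/-- Two sequences are equivalent if their difference tends to `0` in `‖·‖₂`. -/
def SeqEquiv (Ω : K) (x y : ℕ → K →L[ℂ] K) : Prop :=
  Tendsto (fun n => norm2 Ω (x n - y n)) atTop (𝓝 0)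

variable [CompleteSpace K]

/-- A central sequence in `N`: an operator-norm bounded sequence in `N` asymptotically commuting
in `‖·‖₂` with each element of `N`. -/
structure IsCentralSeq (N : VonNeumannAlgebra K) (Ω : K) (x : ℕ → K →L[ℂ] K) : Prop where
  mem : ∀ n, x n ∈ N
  bounded : ∃ C : ℝ, ∀ n, ‖x n‖ ≤ C
  central : ∀ y ∈ N, Tendsto (fun n => norm2 Ω (x n * y - y * x n)) atTop (𝓝 0)

/-- `N` is a factor of type `II₁`: its center is trivial, it is finite (every isometry in `N` is
unitary) and it is infinite-dimensional. -/
structure IsTypeIIOneFactor (N : VonNeumannAlgebra K) : Prop where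
  factor : ∀ x ∈ N, (∀ y ∈ N, x * y = y * x) → ∃ c : ℂ, x = c • (1 : K →L[ℂ] K)
  finite : ∀ v ∈ N, star v * v = 1 → v * star v = 1
  infinite_dim : ¬ FiniteDimensional ℂ N

/-- Every central sequence `(x_n)` of `N` is equivalent to the scalar sequence `(τ(x_n))`, where
`τ = ⟨· Ω, Ω⟩`. -/
def IsFull (N : VonNeumannAlgebra K) (Ω : K) : Prop :=
  ∀ x : ℕ → K →L[ℂ] K, IsCentralSeq N Ω x →
    SeqEquiv Ω x (fun n => vecState Ω (x n) • (1 : K →L[ℂ] K))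

end Factors

/-- The coefficient `x(g) = τ(x λ(g⁻¹))` of `x = ∑ x(g) λ(g)`, for `x` in the copy of the group
von Neumann algebra in the crossed product. -/
noncomputable def fourierCoeff {H : Type u} [NormedAddCommGroup H] [InnerProductSpace ℂ H]
    [CompleteSpace H] {M : VonNeumannAlgebra H} (τ : M →ₚ[ℂ] ℂ) {Γ : Type v} [Group Γ]
    (x : L2 Γ τ.GNS →L[ℂ] L2 Γ τ.GNS) (g : Γ) : ℂ :=
  vecState (cpVector τ Γ) (x * lam τ.GNS g⁻¹)

end VNCrossed

/-!
Write `K = ℓ²(Γ, E)` with `E = L²(M, τ)`, and `Ω = ξ_τ ⊗ δ_1`. The right multiplications by `M`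
and the right translations `(ζ λ(g)⁻¹)(h) = α_g(ζ(h g))` lie in the commutant of `N = M ⋊ Γ` and
move `Ω` to the vectors `a ξ_τ ⊗ δ_g`. Hence `Ω` is separating for `N`
(`eq_zero_of_apply_cpVector_eq_zero`), and duality against these vectors shows
`‖y* Ω‖ = ‖y Ω‖` for `y ∈ N` (`norm_star_apply_cpVector`): the vector state is a faithful trace.

Let `(x_n)` be a central sequence and `ζ_n = x_n Ω`. Asymptotic commutation with `λ(g)` says that
`α_g(ζ_n(g⁻¹ k g))` is close to `ζ_n(k)` in `K`.
* The coordinate norms `‖ζ_n(k)‖` are thus asymptotically conjugation invariant, so if mass off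
  the center `Z` persisted, a limit of normalized masses would be an invariant mean on
  `(Γ ⧸ Z) \ {1}` (`tendsto_norm_restr_compl`).
* For `k ∈ Z` the vectors `ζ_n(k)` are almost `α`-invariant, and s-strong ergodicity gives a
  spectral gap with finitely many group elements and one constant (`exists_spectral_gap`). The
  estimate can therefore be summed over `Z`.

So `ζ_n` is asymptotically in `ξ_τ ⊗ ℓ²(Z)` (`IsCentralSeq.tendsto_norm_sub_tensProj`). With `e` the
projection onto this space, `exists_condExp` yields `c_n ∈ L(Z)` with `‖c_n‖ ≤ ‖x_n‖` and
`c_n Ω = e x_n Ω`. It is defined by `c_n (T Ω) = T (e x_n Ω)` for `T ∈ L(Z)'`, and is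
bounded because `e x_n e` and `e T* T e` are both Toeplitz over the abelian group `Z`, hence commute.
Since `(c_n)` is again central, commuting with an `a ∈ M` which `α_z` moves forces `c_n(z) → 0`
for `z ≠ 1` (`IsCentralSeq.tendsto_coeff`).

Constant sequences give factoriality, and for finite `Z` the convergence of the coefficients gives
fullness. Finally `Γ ⧸ Z` is infinite, since finite nontrivial groups are inner amenable, so `N`,
which contains the linearly independent `λ(g)`, is infinite-dimensional.
-/

namespace VNCrossed

/-! ### Von Neumann algebras with a tracial vector -/

section TracialVector

theorem norm_eq_of_inner_self_eq {V W : Type*} [NormedAddCommGroup V] [InnerProductSpace ℂ V]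
    [NormedAddCommGroup W] [InnerProductSpace ℂ W] {v : V} {w : W}
    (h : inner ℂ v v = (inner ℂ w w : ℂ)) : ‖v‖ = ‖w‖ := by
  rw [inner_self_eq_norm_sq_to_K, inner_self_eq_norm_sq_to_K] at h
  have h5 : ‖v‖ ^ 2 = ‖w‖ ^ 2 := by exact_mod_cast h
  exact (sq_eq_sq₀ (norm_nonneg _) (norm_nonneg _)).1 h5


variable {K : Type u} [NormedAddCommGroup K] [InnerProductSpace ℂ K]

variable {Ω : K}

theorem norm2_mul_le_opNorm_mul (d y : K →L[ℂ] K) : norm2 Ω (d * y) ≤ ‖d‖ * norm2 Ω y :=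
  d.le_opNorm _

theorem norm2_add_le (x y : K →L[ℂ] K) : norm2 Ω (x + y) ≤ norm2 Ω x + norm2 Ω y :=
  norm_add_le _ _

theorem norm2_nonneg (x : K →L[ℂ] K) : 0 ≤ norm2 Ω x := norm_nonneg _

theorem norm2_sub_comm (x y : K →L[ℂ] K) : norm2 Ω (x - y) = norm2 Ω (y - x) :=
  norm_sub_rev (x Ω) (y Ω)

theorem norm_sub_inner_smul_le (hΩ : ‖Ω‖ = 1) (u w : K) :
    ‖u - (inner ℂ Ω u : ℂ) • Ω‖ ≤ 2 * ‖u - w‖ + ‖w - (inner ℂ Ω w : ℂ) • Ω‖ := by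
  have hd : ‖(inner ℂ Ω (u - w) : ℂ) • Ω‖ ≤ ‖u - w‖ := by
    rw [norm_smul, hΩ, mul_one]
    refine (norm_inner_le_norm Ω (u - w)).trans (le_of_eq ?_)
    rw [hΩ, one_mul]
  have hsplit : u - (inner ℂ Ω u : ℂ) • Ω = (u - w) + (w - (inner ℂ Ω w : ℂ) • Ω) -
      (inner ℂ Ω (u - w) : ℂ) • Ω := by
    rw [inner_sub_right, sub_smul]
    abel
  rw [hsplit]
  refine (norm_sub_le _ _).trans ?_
  have h3 := norm_add_le (u - w) (w - (inner ℂ Ω w : ℂ) • Ω)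
  linarith

variable [CompleteSpace K]

theorem mem_generatedBy_iff {S : Set (K →L[ℂ] K)} {x : K →L[ℂ] K} :
    x ∈ VonNeumannAlgebra.generatedBy S ↔
      ∀ T : K →L[ℂ] K, (∀ s ∈ S, s * T = T * s ∧ star s * T = T * star s) → T * x = x * T := by
  change x ∈ StarSubalgebra.centralizer ℂ
    (StarSubalgebra.centralizer ℂ S : Set (K →L[ℂ] K)) ↔ _
  rw [StarSubalgebra.mem_centralizer_iff ℂ]
  constructor
  · intro h T hT
    exact (h T ((StarSubalgebra.mem_centralizer_iff ℂ).2 hT)).1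
  · intro h T hT
    exact ⟨h T ((StarSubalgebra.mem_centralizer_iff ℂ).1 hT),
      h (star T) ((StarSubalgebra.mem_centralizer_iff ℂ).1 (star_mem hT))⟩

theorem subset_generatedBy {S : Set (K →L[ℂ] K)} {x : K →L[ℂ] K} (hx : x ∈ S) :
    x ∈ VonNeumannAlgebra.generatedBy S :=
  mem_generatedBy_iff.2 fun _ hT => (hT x hx).1.symm

theorem inner_star_apply (x : K →L[ℂ] K) (v w : K) :
    inner ℂ (star x v) w = inner ℂ v (x w) :=
  ContinuousLinearMap.adjoint_inner_left x w v

variable {N : VonNeumannAlgebra K}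

/-- In the presence of a tracial vector, `‖d y‖₂ ≤ ‖y‖ ‖d‖₂`. -/
theorem norm2_mul_le (htr : ∀ y ∈ N, ‖star y Ω‖ = ‖y Ω‖) {d y : K →L[ℂ] K} (hd : d ∈ N)
    (hy : y ∈ N) : norm2 Ω (d * y) ≤ ‖y‖ * norm2 Ω d := by
  unfold norm2
  rw [← htr _ (mul_mem hd hy), star_mul, ← htr d hd, ← norm_star y]
  exact (star y).le_opNorm _

/-- A von Neumann algebra with a separating tracial unit vector is finite. -/
theorem mul_star_eq_one_of_tracial (hΩ : ‖Ω‖ = 1) (htr : ∀ y ∈ N, ‖star y Ω‖ = ‖y Ω‖)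
    (hsep : ∀ y ∈ N, y Ω = 0 → y = 0) {w : K →L[ℂ] K} (hw : w ∈ N) (h : star w * w = 1) :
    w * star w = 1 := by
  have hmem : 1 - w * star w ∈ N := sub_mem (one_mem N) (mul_mem hw (star_mem hw))
  refine (sub_eq_zero.1 (hsep _ hmem ?_)).symm
  have hiso : ∀ v : K, ‖w v‖ = ‖v‖ := fun v => norm_eq_of_inner_self_eq (by
    rw [← inner_star_apply]
    change inner ℂ ((star w * w) v) v = _
    rw [h]
    rfl)
  have h1 : ‖w Ω‖ = 1 := (hiso Ω).trans hΩ
  have h3 : ‖w (star w Ω)‖ = 1 := by rw [hiso, htr w hw, h1]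
  have h6 : inner ℂ Ω (w (star w Ω)) = (1 : ℂ) := by
    rw [← inner_star_apply, inner_self_eq_norm_sq_to_K, htr w hw, h1]
    simp
  have h7 : ‖Ω - w (star w Ω)‖ ^ 2 = 0 := by
    rw [@norm_sub_sq ℂ, h6, hΩ, h3]
    norm_num
  simpa using h7

theorem IsCentralSeq.congr (htr : ∀ y ∈ N, ‖star y Ω‖ = ‖y Ω‖) {x c : ℕ → K →L[ℂ] K}
    (hx : IsCentralSeq N Ω x) (hc : ∀ n, c n ∈ N) (hb : ∃ C : ℝ, ∀ n, ‖c n‖ ≤ C)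
    (hxc : SeqEquiv Ω x c) : IsCentralSeq N Ω c where
  mem := hc
  bounded := hb
  central y hy := by
    have hlim : Tendsto (fun n => norm2 Ω (x n * y - y * x n) +
        (‖y‖ + ‖y‖) * norm2 Ω (x n - c n)) atTop (𝓝 0) := by
      simpa using (hx.central y hy).add (hxc.const_mul (‖y‖ + ‖y‖))
    refine squeeze_zero (fun _ => norm2_nonneg _) (fun n => ?_) hlim
    have e : c n * y - y * c n = (x n * y - y * x n) +
        ((c n - x n) * y + y * (x n - c n)) := by noncomm_ring
    rw [e, add_mul, norm2_sub_comm (x n) (c n)]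
    refine (norm2_add_le _ _).trans (add_le_add le_rfl ((norm2_add_le _ _).trans (add_le_add
      (norm2_mul_le htr (sub_mem (hc n) (hx.mem n)) hy) ?_)))
    rw [norm2_sub_comm (c n) (x n)]
    exact norm2_mul_le_opNorm_mul _ _

end TracialVector

/-! ### Operators on `ℓ²(Γ, E)` -/

section Operators

variable {Γ : Type v} {E : Type u} [NormedAddCommGroup E]

open Classical in
/-- The elementary tensor `v ⊗ δ_g` in `ℓ²(Γ, E)`. -/
noncomputable def tens (v : E) (g : Γ) : L2 Γ E := lp.single 2 g v

theorem tens_apply_self (v : E) (g : Γ) : tens v g g = v := by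
  classical
  exact lp.single_apply_self (E := fun _ : Γ => E) 2 g v

theorem tens_apply_ne (v : E) {g h : Γ} (hgh : h ≠ g) : tens v g h = 0 := by
  classical
  exact lp.single_apply_ne (E := fun _ : Γ => E) 2 g v hgh

open Classical in
theorem tens_apply (v : E) (g h : Γ) : tens v g h = if h = g then v else 0 := by
  split_ifs with hgh
  · rw [hgh, tens_apply_self]
  · exact tens_apply_ne v hgh

theorem norm_tens (v : E) (g : Γ) : ‖tens v g‖ = ‖v‖ := by
  classical
  exact lp.norm_single (E := fun _ : Γ => E) (by norm_num) g v

theorem norm_coord_le (f : L2 Γ E) (g : Γ) : ‖f g‖ ≤ ‖f‖ :=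
  lp.norm_apply_le_norm (E := fun _ : Γ => E) (by norm_num) f g

theorem summable_norm_sq_comp (f : L2 Γ E) (e : Γ ≃ Γ) : Summable fun g => ‖f (e g)‖ ^ 2 :=
  (Equiv.summable_iff (f := fun g => ‖f g‖ ^ 2) e).2 (summable_norm_sq f)

theorem norm_le_of_norm_inv_le [Group Γ] {f f' : L2 Γ E} (h : ∀ g, ‖f g⁻¹‖ ≤ ‖f' g‖) :
    ‖f‖ ≤ ‖f'‖ := by
  refine le_of_sq_le_sq ?_ (norm_nonneg _)
  rw [norm_sq_eq_tsum, norm_sq_eq_tsum, ← (Equiv.inv Γ).tsum_eq fun g => ‖f g‖ ^ 2]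
  exact (summable_norm_sq_comp f (Equiv.inv Γ)).tsum_le_tsum
    (fun g => pow_le_pow_left₀ (norm_nonneg _) (h g) 2) (summable_norm_sq f')

variable [InnerProductSpace ℂ E]

theorem tens_smul (c : ℂ) (v : E) (g : Γ) : tens (c • v) g = c • tens v g := by
  classical
  exact lp.single_smul (E := fun _ : Γ => E) 2 g c v

theorem inner_tens_left (v : E) (g : Γ) (f : L2 Γ E) :
    inner ℂ (tens v g) f = inner ℂ v (f g) := by
  classical
  exact lp.inner_single_left (G := fun _ : Γ => E) g v f

theorem inner_tens_right (v : E) (g : Γ) (f : L2 Γ E) :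
    inner ℂ f (tens v g) = inner ℂ (f g) v := by
  classical
  exact lp.inner_single_right (G := fun _ : Γ => E) g v f

@[simp]
theorem diagOp_apply {T : Γ → E →L[ℂ] E} {C : ℝ} (hC : 0 ≤ C) (hT : ∀ g, ‖T g‖ ≤ C)
    (f : L2 Γ E) (g : Γ) : diagOp T C hC hT f g = T g (f g) := rfl

theorem diagOp_tens {T : Γ → E →L[ℂ] E} {C : ℝ} (hC : 0 ≤ C) (hT : ∀ g, ‖T g‖ ≤ C)
    (v : E) (g : Γ) : diagOp T C hC hT (tens v g) = tens (T g v) g := by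
  classical
  ext h
  rw [diagOp_apply, tens_apply, tens_apply]
  split_ifs with hh
  · rw [hh]
  · exact map_zero _

theorem star_diagOp [CompleteSpace E] {S T : Γ → E →L[ℂ] E} {C D : ℝ} (hC : 0 ≤ C)
    (hT : ∀ g, ‖T g‖ ≤ C) (hD : 0 ≤ D) (hS : ∀ g, ‖S g‖ ≤ D) (hST : ∀ g, S g = star (T g)) :
    star (diagOp T C hC hT) = diagOp S D hD hS := by
  refine ((ContinuousLinearMap.eq_adjoint_iff _ _).2 fun f f' => ?_).symm
  rw [lp.inner_eq_tsum, lp.inner_eq_tsum]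
  refine tsum_congr fun g => ?_
  rw [diagOp_apply, diagOp_apply, hST]
  exact ContinuousLinearMap.adjoint_inner_left (T g) _ _

/-- The amplification `T ⊗ 1` of an operator on `E` to `ℓ²(Γ, E) = E ⊗ ℓ²(Γ)`. -/
noncomputable def ampl (Γ : Type v) (T : E →L[ℂ] E) : L2 Γ E →L[ℂ] L2 Γ E :=
  diagOp (fun _ => T) ‖T‖ (norm_nonneg _) fun _ => le_rfl

@[simp]
theorem ampl_apply (T : E →L[ℂ] E) (f : L2 Γ E) (g : Γ) : ampl Γ T f g = T (f g) := rfl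

theorem ampl_tens (T : E →L[ℂ] E) (v : E) (g : Γ) : ampl Γ T (tens v g) = tens (T v) g :=
  diagOp_tens _ _ _ _

open Classical in
/-- The restriction `ζ ↦ 1_A ζ` to a subset `A` of `Γ`. -/
noncomputable def restr (E : Type u) [NormedAddCommGroup E] [InnerProductSpace ℂ E]
    (A : Set Γ) : L2 Γ E →L[ℂ] L2 Γ E :=
  diagOp (fun g => if g ∈ A then ContinuousLinearMap.id ℂ E else 0) 1 zero_le_one fun g => by
    split_ifs
    · exact ContinuousLinearMap.norm_id_le
    · simp

open Classical in
theorem restr_apply (A : Set Γ) (f : L2 Γ E) (g : Γ) :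
    restr E A f g = if g ∈ A then f g else 0 := by
  unfold restr
  rw [diagOp_apply]
  split_ifs <;> rfl

open Classical in
theorem norm_restr_sq (A : Set Γ) (f : L2 Γ E) :
    ‖restr E A f‖ ^ 2 = ∑' g, if g ∈ A then ‖f g‖ ^ 2 else 0 := by
  rw [norm_sq_eq_tsum]
  refine tsum_congr fun g => ?_
  rw [restr_apply]
  split_ifs <;> simp

theorem norm_restr_le (A : Set Γ) (f : L2 Γ E) : ‖restr E A f‖ ≤ ‖f‖ := by
  have h : ‖restr E A‖ ≤ 1 := by
    unfold restr diagOp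
    exact LinearMap.mkContinuous_norm_le _ zero_le_one _
  simpa using (restr E A).le_of_opNorm_le h f

theorem norm_restr_union_sq {A B : Set Γ} (hAB : Disjoint A B) (f : L2 Γ E) :
    ‖restr E (A ∪ B) f‖ ^ 2 = ‖restr E A f‖ ^ 2 + ‖restr E B f‖ ^ 2 := by
  classical
  have hs : ∀ A : Set Γ, Summable fun g => if g ∈ A then ‖f g‖ ^ 2 else 0 := fun A =>
    (summable_norm_sq f).of_nonneg_of_le (fun g => by split_ifs <;> positivity)
      (fun g => by split_ifs <;> simp)
  rw [norm_restr_sq, norm_restr_sq, norm_restr_sq, ← (hs A).tsum_add (hs B)]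
  refine tsum_congr fun g => ?_
  have hg : g ∈ A → g ∉ B := fun h => Set.disjoint_left.1 hAB h
  by_cases h1 : g ∈ A <;> by_cases h2 : g ∈ B <;> simp_all

theorem norm_add_norm_restr_compl_sq (A : Set Γ) (f : L2 Γ E) :
    ‖f‖ ^ 2 = ‖restr E A f‖ ^ 2 + ‖restr E Aᶜ f‖ ^ 2 := by
  rw [← norm_restr_union_sq disjoint_compl_right, Set.union_compl_self]
  congr 2
  ext g
  simp [restr_apply]

/-- A vector of `ℓ²(Γ, E)` whose coordinates are orthogonal to a dense set vanishes. -/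
theorem eq_zero_of_inner_tens {D : Set E} (hD : Dense D) {f : L2 Γ E}
    (h : ∀ v ∈ D, ∀ g, inner ℂ (tens v g) f = (0 : ℂ)) : f = 0 := by
  ext g
  change f g = 0
  have : ∀ v : E, inner ℂ v (f g) = (0 : ℂ) := fun v =>
    isClosed_property (p := fun v : E => inner ℂ v (f g) = (0 : ℂ)) hD.denseRange_val
      (isClosed_eq (by fun_prop) continuous_const)
      (fun v : D => by rw [← inner_tens_left]; exact h v v.2 g) v
  exact inner_self_eq_zero.1 (this (f g))

/-- A subspace of `ℓ²(Γ, E)` is dense as soon as it contains `v ⊗ δ_g` for all `v` in a dense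
set. -/
theorem topologicalClosure_eq_top_of_tens_mem [CompleteSpace E] {D : Set E} (hD : Dense D)
    {S : Submodule ℂ (L2 Γ E)}
    (h : ∀ v ∈ D, ∀ g, tens v g ∈ S) : S.topologicalClosure = ⊤ := by
  rw [Submodule.topologicalClosure_eq_top_iff, Submodule.eq_bot_iff]
  intro f hf
  exact eq_zero_of_inner_tens hD fun v hv g => (Submodule.mem_orthogonal _ _).1 hf _ (h v hv g)

variable [Group Γ]

@[simp]
theorem lam_apply (g : Γ) (f : L2 Γ E) (h : Γ) : lam E g f h = f (g⁻¹ * h) := rfl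

theorem lam_tens (g : Γ) (v : E) (h : Γ) : lam E g (tens v h) = tens v (g * h) := by
  classical
  ext k
  rw [lam_apply, tens_apply, tens_apply]
  simp only [inv_mul_eq_iff_eq_mul]

theorem star_lam [CompleteSpace E] (g : Γ) : star (lam E g) = lam E g⁻¹ := by
  refine ((ContinuousLinearMap.eq_adjoint_iff _ _).2 fun f f' => ?_).symm
  rw [lp.inner_eq_tsum, lp.inner_eq_tsum, ← (Equiv.mulLeft g⁻¹).tsum_eq]
  refine tsum_congr fun k => ?_
  simp

theorem norm_lam_apply (g : Γ) (f : L2 Γ E) : ‖lam E g f‖ = ‖f‖ := by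
  have : ‖lam E g f‖ ^ 2 = ‖f‖ ^ 2 := by
    rw [norm_sq_eq_tsum, norm_sq_eq_tsum]
    exact (Equiv.mulLeft g⁻¹).tsum_eq fun h => ‖f h‖ ^ 2
  exact (sq_eq_sq₀ (norm_nonneg _) (norm_nonneg _)).1 this

/-- The right translation operator `(ρ(g) ξ)(h) = ξ(h g)`. -/
noncomputable def rightTrans (E : Type u) [NormedAddCommGroup E] [InnerProductSpace ℂ E] (g : Γ) :
    L2 Γ E →L[ℂ] L2 Γ E :=
  LinearMap.mkContinuous
    { toFun := fun f => ⟨fun h => f (h * g), memlp_two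
        (summable_norm_sq_comp f (Equiv.mulRight g))⟩
      map_add' := fun f f' => by ext h; rfl
      map_smul' := fun c f => by ext h; rfl } 1 (fun f => by
    rw [one_mul]
    refine le_of_sq_le_sq ?_ (norm_nonneg _)
    rw [norm_sq_eq_tsum, norm_sq_eq_tsum]
    exact le_of_eq ((Equiv.mulRight g).tsum_eq fun h => ‖f h‖ ^ 2))

@[simp]
theorem rightTrans_apply (g : Γ) (f : L2 Γ E) (h : Γ) : rightTrans E g f h = f (h * g) := rfl

theorem rightTrans_tens (g : Γ) (v : E) (h : Γ) :
    rightTrans E g (tens v h) = tens v (h * g⁻¹) := by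
  classical
  ext k
  rw [rightTrans_apply, tens_apply, tens_apply]
  simp only [eq_mul_inv_iff_mul_eq]

theorem lam_mul_ampl (g : Γ) (T : E →L[ℂ] E) : lam E g * ampl Γ T = ampl Γ T * lam E g := by
  ext f k
  rfl

theorem lam_mul_rightTrans (g h : Γ) :
    lam E g * rightTrans E h = rightTrans E h * lam E g := by
  ext f k
  simp [mul_assoc]

end Operators

/-! ### Spectral gap -/

section SpectralGap

variable {Γ : Type v} [Group Γ] {E : Type u} [NormedAddCommGroup E] [InnerProductSpace ℂ E]

theorem inner_sub_inner_smul_self {ξ : E} (hξ : ‖ξ‖ = 1) (w : E) :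
    inner ℂ ξ (w - (inner ℂ ξ w : ℂ) • ξ) = (0 : ℂ) := by
  rw [inner_sub_right, inner_smul_right, inner_self_eq_norm_sq_to_K, hξ]
  simp

/-- If the only sequences of almost invariant unit vectors are those asymptotically proportional
to the invariant vector `ξ`, then finitely many group elements already bound the distance
to `ℂ ξ`. -/
theorem exists_spectral_gap [Countable Γ] {ξ : E} (hξ : ‖ξ‖ = 1) (U : Γ → E →L[ℂ] E)
    (hU : ∀ g, U g ξ = ξ)
    (herg : ∀ η : ℕ → E, (∀ n, ‖η n‖ = 1) →
      (∀ g : Γ, Tendsto (fun n => ‖U g (η n) - η n‖) atTop (𝓝 0)) →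
      Tendsto (fun n => ‖η n - (inner ℂ ξ (η n) : ℂ) • ξ‖) atTop (𝓝 0)) :
    ∃ (F : Finset Γ) (C : ℝ), 0 ≤ C ∧
      ∀ w, ‖w - (inner ℂ ξ w : ℂ) • ξ‖ ^ 2 ≤ C * ∑ g ∈ F, ‖U g w - w‖ ^ 2 := by
  classical
  by_contra! hcon
  obtain ⟨e, he⟩ := exists_surjective_nat Γ
  choose w hw using fun n : ℕ =>
    hcon ((Finset.range n).image e) n (Nat.cast_nonneg n)
  -- the normalized components orthogonal to `ξ` of a sequence of counterexamples
  set p : ℕ → E := fun n => w n - (inner ℂ ξ (w n) : ℂ) • ξ with hp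
  have hpos : ∀ n, 0 < ‖p n‖ := fun n => by
    have h1 : 0 < ‖p n‖ ^ 2 := lt_of_le_of_lt
      (mul_nonneg (Nat.cast_nonneg n) (Finset.sum_nonneg fun _ _ => sq_nonneg _)) (hw n)
    exact (norm_nonneg _).lt_of_ne' fun h => by simp [h] at h1
  have hη : ∀ n, ‖((‖p n‖⁻¹ : ℝ) : ℂ) • p n‖ = 1 := fun n => by
    rw [norm_smul, Complex.norm_real, norm_inv, norm_norm, inv_mul_cancel₀ (hpos n).ne']
  have hinv : ∀ g : Γ, Tendsto (fun n => ‖U g (((‖p n‖⁻¹ : ℝ) : ℂ) • p n) -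
      ((‖p n‖⁻¹ : ℝ) : ℂ) • p n‖) atTop (𝓝 0) := by
    intro g
    obtain ⟨k, rfl⟩ := he g
    have hsq : Tendsto (fun n => ‖U (e k) (((‖p n‖⁻¹ : ℝ) : ℂ) • p n) -
        ((‖p n‖⁻¹ : ℝ) : ℂ) • p n‖ ^ 2) atTop (𝓝 0) := by
      refine squeeze_zero' (Eventually.of_forall fun _ => sq_nonneg _) ?_
        tendsto_one_div_atTop_nhds_zero_nat
      filter_upwards [eventually_gt_atTop k] with n hn
      have h1 : U (e k) (p n) - p n = U (e k) (w n) - w n := by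
        rw [hp]
        simp only [map_sub, map_smul, hU]
        abel
      have h2 : ‖U (e k) (w n) - w n‖ ^ 2 ≤
          ∑ g ∈ (Finset.range n).image e, ‖U g (w n) - w n‖ ^ 2 :=
        Finset.single_le_sum (f := fun g => ‖U g (w n) - w n‖ ^ 2) (fun _ _ => sq_nonneg _)
          (Finset.mem_image_of_mem e (Finset.mem_range.2 hn))
      have h3 : (0 : ℝ) < n := by exact_mod_cast (Nat.zero_le k).trans_lt hn
      have h4 := hw n
      rw [map_smul, ← smul_sub, h1, norm_smul, mul_pow, Complex.norm_real, norm_inv, norm_norm,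
        inv_pow, inv_mul_le_iff₀ (pow_pos (hpos n) 2), mul_one_div, le_div_iff₀ h3, mul_comm]
      exact (mul_le_mul_of_nonneg_left h2 h3.le).trans h4.le
    have h := hsq.sqrt
    simpa only [Real.sqrt_sq (norm_nonneg _), Real.sqrt_zero] using h
  have hlim := herg _ hη hinv
  have hone : ∀ n, ‖((‖p n‖⁻¹ : ℝ) : ℂ) • p n -
      (inner ℂ ξ (((‖p n‖⁻¹ : ℝ) : ℂ) • p n) : ℂ) • ξ‖ = 1 := fun n => by
    rw [inner_smul_right, inner_sub_inner_smul_self hξ, mul_zero, zero_smul, sub_zero, hη]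
  simp only [hone] at hlim
  exact one_ne_zero (tendsto_nhds_unique tendsto_const_nhds hlim)

end SpectralGap

/-! ### Inner amenability -/

section InnerAmenability

variable {Γ : Type v} {E : Type u} [NormedAddCommGroup E] [InnerProductSpace ℂ E]

theorem abs_norm_restr_sq_sub_le (A : Set Γ) {f f' : L2 Γ E} {C : ℝ} (hf : ‖f‖ ≤ C)
    (hf' : ‖f'‖ ≤ C) :
    |‖restr E A f'‖ ^ 2 - ‖restr E A f‖ ^ 2| ≤ ‖f' - f‖ * (2 * C) := by
  have h1 : |‖restr E A f'‖ - ‖restr E A f‖| ≤ ‖f' - f‖ := by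
    refine (abs_norm_sub_norm_le _ _).trans ?_
    rw [← map_sub]
    exact norm_restr_le A _
  have h2 : |‖restr E A f'‖ + ‖restr E A f‖| ≤ 2 * C := by
    rw [abs_of_nonneg (by positivity)]
    linarith [norm_restr_le A f, norm_restr_le A f']
  rw [sq_sub_sq, mul_comm, abs_mul]
  exact mul_le_mul h1 h2 (abs_nonneg _) (norm_nonneg _)

variable [Group Γ]

theorem norm_restr_sq_conj {f f' : L2 Γ E} {g : Γ} (h : ∀ k, ‖f' k‖ = ‖f (g⁻¹ * k * g)‖)
    {A B : Set Γ} (hAB : ∀ k, k ∈ B ↔ g⁻¹ * k * g ∈ A) :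
    ‖restr E B f'‖ ^ 2 = ‖restr E A f‖ ^ 2 := by
  classical
  rw [norm_restr_sq, norm_restr_sq,
    ← (MulAut.conj g⁻¹).toEquiv.tsum_eq fun k => if k ∈ A then ‖f k‖ ^ 2 else 0]
  refine tsum_congr fun k => ?_
  have : (MulAut.conj g⁻¹).toEquiv k = g⁻¹ * k * g := by
    simp
  rw [this, h]
  simp only [hAB]

/-- If the quotient of `Γ` by a normal subgroup `Λ` is not inner amenable, then a bounded sequence
in `ℓ²(Γ, E)` whose coordinate norms are asymptotically invariant under conjugation concentrates
on `Λ`: otherwise the normalized mass distributions off `Λ` would converge, along an ultrafilter,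
to a conjugation-invariant mean on the nontrivial elements of `Γ ⧸ Λ`. -/
theorem tendsto_norm_restr_compl (Λ : Subgroup Γ) [Λ.Normal] (hΛ : ¬ IsInnerAmenable (Γ ⧸ Λ))
    {f : ℕ → L2 Γ E} {C : ℝ} (hC : ∀ n, ‖f n‖ ≤ C)
    (hinv : ∀ g : Γ, ∃ f' : ℕ → L2 Γ E, (∀ n k, ‖f' n k‖ = ‖f n (g⁻¹ * k * g)‖) ∧
      Tendsto (fun n => ‖f' n - f n‖) atTop (𝓝 0)) :
    Tendsto (fun n => ‖restr E (Λ : Set Γ)ᶜ (f n)‖ ^ 2) atTop (𝓝 0) := by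
  by_contra hnot
  apply hΛ
  set s : ℕ → ℝ := fun n => ‖restr E (Λ : Set Γ)ᶜ (f n)‖ ^ 2 with hs
  obtain ⟨ε, hε, hfreq⟩ : ∃ ε > 0, ∃ᶠ n in atTop, ε ≤ s n := by
    by_contra! hcon
    refine hnot (Metric.tendsto_nhds.2 fun ε hε => ?_)
    filter_upwards [hcon ε hε] with n hn
    rw [Real.dist_eq, sub_zero, abs_of_nonneg (sq_nonneg _)]
    exact hn
  have hne : (atTop ⊓ 𝓟 {n | ε ≤ s n}).NeBot := frequently_mem_iff_neBot.1 hfreq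
  -- `U` is an ultrafilter along which the mass off `Λ` stays bounded below
  set U : Ultrafilter ℕ := Ultrafilter.of (atTop ⊓ 𝓟 {n | ε ≤ s n}) with hU
  have hUle : (U : Filter ℕ) ≤ atTop ⊓ 𝓟 {n | ε ≤ s n} := Ultrafilter.of_le _
  have hUtop : (U : Filter ℕ) ≤ atTop := hUle.trans inf_le_left
  have hUs : ∀ᶠ n in (U : Filter ℕ), ε ≤ s n :=
    (hUle.trans inf_le_right) (mem_principal_self _)
  let S : Set (Γ ⧸ Λ) → Set Γ := fun A => (Λ : Set Γ)ᶜ ∩ (QuotientGroup.mk' Λ) ⁻¹' A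
  let μ : ℕ → Set (Γ ⧸ Λ) → ℝ := fun n A => ‖restr E (S A) (f n)‖ ^ 2 / s n
  have hmono : ∀ n A, ‖restr E (S A) (f n)‖ ^ 2 ≤ s n := fun n A => by
    have h := norm_restr_union_sq (E := E) (A := S A) (B := S Aᶜ)
      (disjoint_compl_right.preimage _ |>.mono Set.inter_subset_right Set.inter_subset_right)
      (f n)
    rw [← Set.inter_union_distrib_left, Set.preimage_compl, Set.union_compl_self,
      Set.inter_univ] at h
    change _ ≤ ‖restr E (Λ : Set Γ)ᶜ (f n)‖ ^ 2
    rw [h]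
    exact le_add_of_nonneg_right (sq_nonneg _)
  have hμ : ∀ A, ∃ r, Tendsto (fun n => μ n A) U (𝓝 r) := fun A => by
    have hmem : ∀ n, μ n A ∈ Set.Icc (0 : ℝ) 1 := fun n =>
      ⟨div_nonneg (sq_nonneg _) (sq_nonneg _), div_le_one_of_le₀ (hmono n A) (sq_nonneg _)⟩
    obtain ⟨r, -, hr⟩ := (isCompact_Icc (a := (0 : ℝ)) (b := 1)).ultrafilter_le_nhds
      (U.map fun n => μ n A) (by
        rw [le_principal_iff]
        exact Filter.mem_map.2 (univ_mem' hmem))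
    exact ⟨r, hr⟩
  choose m hm using hμ
  refine ⟨m, fun A => ?_, ?_, fun A B hAB => ?_, ?_, fun q A => ?_⟩
  · exact ge_of_tendsto' (hm A) fun n => div_nonneg (sq_nonneg _) (sq_nonneg _)
  · refine tendsto_nhds_unique (hm Set.univ) (tendsto_const_nhds.congr' ?_)
    filter_upwards [hUs] with n hn
    change 1 = ‖restr E ((Λ : Set Γ)ᶜ ∩ Set.univ) (f n)‖ ^ 2 / s n
    rw [Set.inter_univ]
    exact (div_self (hε.trans_le hn).ne').symm
  · refine tendsto_nhds_unique (hm (A ∪ B)) (((hm A).add (hm B)).congr fun n => ?_)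
    have h := norm_restr_union_sq (E := E) (A := S A) (B := S B)
      (hAB.preimage _ |>.mono Set.inter_subset_right Set.inter_subset_right) (f n)
    rw [← Set.inter_union_distrib_left, ← Set.preimage_union] at h
    change _ = ‖restr E (S (A ∪ B)) (f n)‖ ^ 2 / s n
    rw [show S (A ∪ B) = (Λ : Set Γ)ᶜ ∩ (QuotientGroup.mk' Λ) ⁻¹' (A ∪ B) from rfl, h, add_div]
  · refine tendsto_nhds_unique (hm {1}) (tendsto_const_nhds.congr fun n => ?_)
    have : S {1} = ∅ := by
      ext k
      simp [S]
    have h0 : ‖restr E (∅ : Set Γ) (f n)‖ ^ 2 = 0 := by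
      classical
      rw [norm_restr_sq]
      simp
    change 0 = ‖restr E (S {1}) (f n)‖ ^ 2 / s n
    rw [this, h0, zero_div]
  · obtain ⟨g, rfl⟩ := QuotientGroup.mk'_surjective Λ q
    set B := (fun h => QuotientGroup.mk' Λ g * h * (QuotientGroup.mk' Λ g)⁻¹) '' A with hB
    obtain ⟨f', hf', hlim⟩ := hinv g
    have hSB : ∀ k, k ∈ S B ↔ g⁻¹ * k * g ∈ S A := fun k => by
      have h1 : k ∈ Λ ↔ g⁻¹ * k * g ∈ Λ := by
        have := Subgroup.Normal.mem_comm_iff (H := Λ) ‹_› (a := g) (b := g⁻¹ * k)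
        rw [← this, mul_inv_cancel_left]
      have h2 : QuotientGroup.mk' Λ k ∈ B ↔ QuotientGroup.mk' Λ (g⁻¹ * k * g) ∈ A := by
        rw [hB]
        constructor
        · rintro ⟨h, hh, he⟩
          rw [map_mul, map_mul, map_inv, ← he]
          simpa [mul_assoc] using hh
        · intro hh
          refine ⟨_, hh, ?_⟩
          simp [mul_assoc]
      exact and_congr (not_congr h1) h2
    have hf'C : ∀ n, ‖f' n‖ ≤ C := fun n => by
      have h := norm_restr_sq_conj (hf' n) (A := Set.univ) (B := Set.univ) (by simp)
      have hu : ∀ f : L2 Γ E, restr E Set.univ f = f := fun f => by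
        ext k
        simp [restr_apply]
      rw [hu, hu] at h
      exact ((sq_eq_sq₀ (norm_nonneg _) (norm_nonneg _)).1 h).trans_le (hC n)
    have hdiff : Tendsto (fun n => μ n B - μ n A) U (𝓝 0) := by
      have hb : Tendsto (fun n => ‖f' n - f n‖ * (2 * C) / ε) U (𝓝 0) := by
        simpa using ((hlim.mono_left hUtop).mul_const (2 * C)).div_const ε
      refine squeeze_zero_norm' ?_ hb
      filter_upwards [hUs] with n hn
      have h := abs_norm_restr_sq_sub_le (S B) (hC n) (hf'C n)
      rw [norm_restr_sq_conj (hf' n) hSB, abs_sub_comm] at h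
      change |_ / s n - _ / s n| ≤ _
      rw [← sub_div, abs_div, abs_of_pos (hε.trans_le hn)]
      exact div_le_div₀ ((abs_nonneg _).trans h) h hε hn
    have := tendsto_nhds_unique ((hm B).sub (hm A)) hdiff
    exact sub_eq_zero.1 this

/-- A finite nontrivial group is inner amenable, by the uniform distribution on its nontrivial
elements. -/
theorem isInnerAmenable_of_finite (G : Type v) [Group G] [Finite G] [Nontrivial G] :
    IsInnerAmenable G := by
  have hpos : (0 : ℝ) < ({1}ᶜ : Set G).ncard := by
    obtain ⟨g, hg⟩ := exists_ne (1 : G)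
    exact_mod_cast (Set.ncard_pos (Set.toFinite _)).2 ⟨g, hg⟩
  refine ⟨fun A => (A \ {1}).ncard / ({1}ᶜ : Set G).ncard, fun A => by positivity, ?_,
    fun A B hAB => ?_, by simp, fun g A => ?_⟩
  · dsimp only
    rw [← Set.compl_eq_univ_sdiff]
    exact div_self hpos.ne'
  · dsimp only
    rw [Set.union_sdiff_distrib, Set.ncard_union_eq
      (hAB.mono Set.sdiff_subset Set.sdiff_subset) (Set.toFinite _) (Set.toFinite _)]
    push_cast
    exact add_div _ _ _
  · have hinj : Function.Injective fun h => g * h * g⁻¹ := (MulAut.conj g).injective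
    have h1 : (fun h => g * h * g⁻¹) '' A \ {1} = (fun h => g * h * g⁻¹) '' (A \ {1}) := by
      rw [Set.image_sdiff hinj, Set.image_singleton]
      simp
    dsimp only
    rw [h1, Set.ncard_image_of_injective _ hinj]

end InnerAmenability

/-! ### The conditional expectation onto the von Neumann algebra of an abelian subgroup -/

section CondExp

/-- If `A` commutes with `T* T` then `A` is bounded in the seminorm `‖T ·‖`, as it commutes with the
square root of `T* T`. -/
theorem norm_apply_le_of_commute {K : Type u} [NormedAddCommGroup K] [InnerProductSpace ℂ K]
    [CompleteSpace K] {A T : K →L[ℂ] K} (hA : Commute (star T * T) A) (f : K) :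
    ‖T (A f)‖ ≤ ‖A‖ * ‖T f‖ := by
  set s := CFC.sqrt (star T * T)
  have hsA : Commute s A := hA.cfcₙ_nnreal _
  have hss : star s = s := (CFC.sqrt_nonneg (star T * T)).isSelfAdjoint.star_eq
  have hsP : star s * s = star T * T := by
    rw [hss]
    exact CFC.sqrt_mul_sqrt_self _ (star_mul_self_nonneg T)
  have hinner : ∀ (S : K →L[ℂ] K) f, inner ℂ (S f) (S f) = (inner ℂ f ((star S * S) f) : ℂ) :=
    fun S f => (ContinuousLinearMap.adjoint_inner_right S f (S f)).symm
  have hnorm : ∀ f, ‖s f‖ = ‖T f‖ := fun f =>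
    norm_eq_of_inner_self_eq (by rw [hinner, hsP, hinner])
  rw [← hnorm, ← hnorm, show s (A f) = A (s f) from DFunLike.congr_fun hsA.eq f]
  exact A.le_opNorm _

variable {Γ : Type v} {E : Type u} [NormedAddCommGroup E] [InnerProductSpace ℂ E]

open Classical in
/-- The orthogonal projection of `ℓ²(Γ, E)` onto `ξ ⊗ ℓ²(A)`, for a unit vector `ξ`. -/
noncomputable def tensProj (ξ : E) (A : Set Γ) : L2 Γ E →L[ℂ] L2 Γ E :=
  diagOp (fun k => if k ∈ A then InnerProductSpace.rankOne ℂ ξ ξ else 0)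
    ‖InnerProductSpace.rankOne ℂ ξ ξ‖ (norm_nonneg _) fun k => by
      split_ifs
      · exact le_rfl
      · rw [norm_zero]
        exact norm_nonneg _

open Classical in
theorem tensProj_apply (ξ : E) (A : Set Γ) (f : L2 Γ E) (k : Γ) :
    tensProj ξ A f k = if k ∈ A then (inner ℂ ξ (f k) : ℂ) • ξ else 0 := by
  unfold tensProj
  rw [diagOp_apply]
  split_ifs <;> simp

open Classical in
theorem tensProj_tens (ξ : E) (A : Set Γ) (w : E) (k : Γ) :
    tensProj ξ A (tens w k) = if k ∈ A then (inner ℂ ξ w : ℂ) • tens ξ k else 0 := by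
  unfold tensProj
  rw [diagOp_tens]
  split_ifs
  · rw [InnerProductSpace.rankOne_apply, tens_smul]
  · ext h
    simp [tens_apply]

variable {ξ : E}

theorem tensProj_tens_self (hξ : ‖ξ‖ = 1) {A : Set Γ} {k : Γ} (hk : k ∈ A) :
    tensProj ξ A (tens ξ k) = tens ξ k := by
  rw [tensProj_tens, if_pos hk, inner_self_eq_norm_sq_to_K, hξ]
  simp

theorem tensProj_apply_eq_smul (hξ : ‖ξ‖ = 1) (A : Set Γ) (f : L2 Γ E) (k : Γ) :
    tensProj ξ A f k = (inner ℂ ξ (tensProj ξ A f k) : ℂ) • ξ := by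
  classical
  rw [tensProj_apply]
  split_ifs
  · rw [inner_smul_right, inner_self_eq_norm_sq_to_K, hξ]
    simp
  · simp

theorem norm_tensProj_apply_le (hξ : ‖ξ‖ = 1) (A : Set Γ) (f : L2 Γ E) :
    ‖tensProj ξ A f‖ ≤ ‖f‖ := by
  have h : ‖tensProj ξ A‖ ≤ 1 := by
    have h1 : ‖tensProj ξ A‖ ≤ ‖InnerProductSpace.rankOne ℂ ξ ξ‖ := by
      unfold tensProj diagOp
      exact LinearMap.mkContinuous_norm_le _ (norm_nonneg _) _
    simpa [hξ] using h1
  simpa using (tensProj ξ A).le_of_opNorm_le h f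

theorem tensProj_mul_self (hξ : ‖ξ‖ = 1) (A : Set Γ) :
    tensProj ξ A * tensProj ξ A = tensProj ξ A := by
  classical
  ext f k
  change tensProj ξ A (tensProj ξ A f) k = _
  rw [tensProj_apply, tensProj_apply]
  split_ifs
  · rw [inner_smul_right, inner_self_eq_norm_sq_to_K, hξ]
    simp
  · rfl

theorem eq_smul_tens_of_inner_eq_zero (hξ : ‖ξ‖ = 1) {A : Set Γ} {f f' : L2 Γ E}
    (hf : f = tensProj ξ A f') (o : Γ) (h : ∀ z, z ≠ o → inner ℂ ξ (f z) = (0 : ℂ)) :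
    f = (inner ℂ ξ (f o) : ℂ) • tens ξ o := by
  have hk : ∀ k, f k = (inner ℂ ξ (f k) : ℂ) • ξ := fun k => by
    rw [hf]
    exact tensProj_apply_eq_smul hξ A f' k
  ext k
  change f k = (inner ℂ ξ (f o) : ℂ) • tens ξ o k
  by_cases hko : k = o
  · rw [hko, tens_apply_self]
    exact hk o
  · rw [tens_apply_ne ξ hko, smul_zero, hk, h k hko, zero_smul]

theorem norm_sub_smul_tens_le (hξ : ‖ξ‖ = 1) {A : Set Γ} {f f' : L2 Γ E}
    (hf : f = tensProj ξ A f') (o : Γ) {K : Finset Γ} (hK : ∀ k, k ∈ K ↔ k ∈ A ∧ k ≠ o) :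
    ‖f - (inner ℂ ξ (f o) : ℂ) • tens ξ o‖ ≤ ∑ z ∈ K, ‖(inner ℂ ξ (f z) : ℂ)‖ := by
  classical
  have hk1 : ∀ k, f k = (inner ℂ ξ (f k) : ℂ) • ξ := fun k => by
    rw [hf]
    exact tensProj_apply_eq_smul hξ A f' k
  have hk0 : ∀ k, k ∉ A → f k = 0 := fun k hk => by
    rw [hf, tensProj_apply, if_neg hk]
  have hsum : f - (inner ℂ ξ (f o) : ℂ) • tens ξ o =
      ∑ z ∈ K, (inner ℂ ξ (f z) : ℂ) • tens ξ z := by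
    ext k
    have h1 : (∑ z ∈ K, (inner ℂ ξ (f z) : ℂ) • tens ξ z) k = if k ∈ K then f k else 0 := by
      rw [lp.coeFn_sum, Finset.sum_apply, ← Finset.sum_ite_eq]
      refine Finset.sum_congr rfl fun z _ => ?_
      rw [lp.coeFn_smul, Pi.smul_apply, tens_apply]
      split_ifs with hkz
      · rw [← hkz]
        exact (hk1 k).symm
      · exact smul_zero _
    rw [h1]
    change f k - (inner ℂ ξ (f o) : ℂ) • tens ξ o k = _
    rw [tens_apply]
    by_cases hko : k = o
    · rw [if_pos hko, hko, ← hk1, sub_self, if_neg fun h => ((hK o).1 h).2 rfl]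
    · rw [if_neg hko, smul_zero, sub_zero]
      by_cases hkA : k ∈ A
      · rw [if_pos ((hK k).2 ⟨hkA, hko⟩)]
      · rw [if_neg fun h => hkA ((hK k).1 h).1, hk0 k hkA]
  rw [hsum]
  refine (norm_sum_le _ _).trans (Finset.sum_le_sum fun z _ => ?_)
  rw [norm_smul, norm_tens, hξ, mul_one]

section Toeplitz

variable [Group Γ]

/-- The compression of `a` to `ξ ⊗ ℓ²(Λ)` commutes with the right translations by `Λ`. -/
def IsToeplitz (ξ : E) (Λ : Subgroup Γ) (a : L2 Γ E →L[ℂ] L2 Γ E) : Prop :=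
  ∀ r ∈ Λ, ∀ t ∈ Λ, ∀ z ∈ Λ, inner ℂ (tens ξ (r * z)) (a (tens ξ (t * z))) =
    (inner ℂ (tens ξ r) (a (tens ξ t)) : ℂ)

/-- An operator commuting with a family of isometries that act on `ξ ⊗ ℓ²(Λ)` as the right
translations is Toeplitz. -/
theorem IsToeplitz.of_isometry {Λ : Subgroup Γ} {a : L2 Γ E →L[ℂ] L2 Γ E}
    (V : Γ → L2 Γ E → L2 Γ E)
    (hV : ∀ z f f', inner ℂ (V z f) (V z f') = (inner ℂ f f' : ℂ))
    (hVξ : ∀ z ∈ Λ, ∀ t ∈ Λ, V z (tens ξ t) = tens ξ (t * z))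
    (hVa : ∀ z ∈ Λ, ∀ f, a (V z f) = V z (a f)) :
    IsToeplitz ξ Λ a := fun r hr t ht z hz => by
  rw [← hVξ z hz r hr, ← hVξ z hz t ht, hVa z hz, hV]

end Toeplitz

variable [CompleteSpace E]

theorem star_tensProj (ξ : E) (A : Set Γ) : star (tensProj ξ A) = tensProj ξ A := by
  classical
  unfold tensProj
  refine star_diagOp _ _ _ _ fun g => ?_
  split_ifs
  · exact (InnerProductSpace.adjoint_rankOne ξ ξ).symm
  · exact (star_zero _).symm

/-- An operator on `ξ ⊗ ℓ²(A)` is determined by its matrix coefficients. -/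
theorem eq_of_inner_tens_eq {A : Set Γ} {B D : L2 Γ E →L[ℂ] L2 Γ E}
    (h : ∀ r ∈ A, ∀ t ∈ A, inner ℂ (tens ξ r) (B (tens ξ t)) =
      (inner ℂ (tens ξ r) (D (tens ξ t)) : ℂ)) :
    tensProj ξ A * B * tensProj ξ A = tensProj ξ A * D * tensProj ξ A := by
  classical
  have h1 : ∀ t ∈ A, tensProj ξ A (B (tens ξ t)) = tensProj ξ A (D (tens ξ t)) := by
    intro t ht
    ext k
    rw [tensProj_apply, tensProj_apply]
    split_ifs with hk
    · rw [← inner_tens_left, ← inner_tens_left, h k hk t ht]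
    · rfl
  have h2 := topologicalClosure_eq_top_of_tens_mem (Γ := Γ) (D := (Set.univ : Set E))
    (S := LinearMap.ker (tensProj ξ A * B * tensProj ξ A - tensProj ξ A * D * tensProj ξ A :
      L2 Γ E →L[ℂ] L2 Γ E).toLinearMap) dense_univ (by
      rintro w - k
      change tensProj ξ A (B (tensProj ξ A (tens w k))) -
        tensProj ξ A (D (tensProj ξ A (tens w k))) = 0
      rw [tensProj_tens]
      split_ifs with hk
      · rw [map_smul, map_smul, map_smul, map_smul, h1 k hk, sub_self]
      · simp)
  have hc : IsClosed (LinearMap.ker (tensProj ξ A * B * tensProj ξ A -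
      tensProj ξ A * D * tensProj ξ A : L2 Γ E →L[ℂ] L2 Γ E).toLinearMap : Set (L2 Γ E)) :=
    ContinuousLinearMap.isClosed_ker _
  rw [hc.submodule_topologicalClosure_eq] at h2
  rw [← sub_eq_zero]
  ext1 f
  exact (h2 ▸ Submodule.mem_top : f ∈ LinearMap.ker (tensProj ξ A * B * tensProj ξ A -
    tensProj ξ A * D * tensProj ξ A : L2 Γ E →L[ℂ] L2 Γ E).toLinearMap)

open Classical in
theorem hasSum_inner_mul_tensProj_mul (a p : L2 Γ E →L[ℂ] L2 Γ E) (A : Set Γ) (r t : Γ) :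
    HasSum (fun k => if k ∈ A then (inner ℂ (tens ξ r) (a (tens ξ k)) : ℂ) *
      inner ℂ (tens ξ k) (p (tens ξ t)) else 0)
      (inner ℂ (tens ξ r) ((a * tensProj ξ A * p) (tens ξ t))) := by
  have h := lp.hasSum_inner (𝕜 := ℂ) (star a (tens ξ r)) (tensProj ξ A (p (tens ξ t)))
  rw [inner_star_apply] at h
  refine h.congr_fun fun k => ?_
  rw [tensProj_apply]
  split_ifs
  · rw [inner_smul_right, ← inner_tens_left, ← inner_tens_right, inner_star_apply, mul_comm]
  · rw [inner_zero_right]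

variable [Group Γ]

/-- Toeplitz operators over an abelian group commute. -/
theorem IsToeplitz.commute_compression (hξ : ‖ξ‖ = 1) {Λ : Subgroup Γ}
    (hΛ : ∀ r ∈ Λ, ∀ t ∈ Λ, r * t = t * r) {a p : L2 Γ E →L[ℂ] L2 Γ E} (ha : IsToeplitz ξ Λ a)
    (hp : IsToeplitz ξ Λ p) :
    Commute (tensProj ξ (Λ : Set Γ) * a * tensProj ξ (Λ : Set Γ))
      (tensProj ξ (Λ : Set Γ) * p * tensProj ξ (Λ : Set Γ)) := by
  classical
  set e := tensProj ξ (Λ : Set Γ) with he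
  have hee : e * e = e := tensProj_mul_self hξ _
  have key : e * (a * e * p) * e = e * (p * e * a) * e := by
    refine eq_of_inner_tens_eq fun r hr t ht => ?_
    refine (hasSum_inner_mul_tensProj_mul a p (Λ : Set Γ) r t).unique ?_
    have h := hasSum_inner_mul_tensProj_mul (ξ := ξ) p a (Λ : Set Γ) r t
    -- reindex by the involution `k ↦ r k⁻¹ t` of `Λ`
    let σ : Γ ≃ Γ := (Equiv.inv Γ).trans ((Equiv.mulLeft r).trans (Equiv.mulRight t))
    rw [← σ.hasSum_iff] at h
    refine h.congr_fun fun k => ?_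
    have hσ : σ k = r * k⁻¹ * t := rfl
    have hmem : σ k ∈ (Λ : Set Γ) ↔ k ∈ (Λ : Set Γ) := by
      rw [hσ]
      change r * k⁻¹ * t ∈ Λ ↔ k ∈ Λ
      rw [Subgroup.mul_mem_cancel_right _ ht, Subgroup.mul_mem_cancel_left _ hr, inv_mem_iff]
    simp only [Function.comp_apply, hmem]
    split_ifs with hk
    · have hk' : r * k⁻¹ * t ∈ Λ := hmem.2 hk
      have h1 := hp r hr _ hk' (r⁻¹ * k) (mul_mem (inv_mem hr) hk)
      have h2 := ha _ hk' t ht (t⁻¹ * k) (mul_mem (inv_mem ht) hk)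
      have e1 : r * k⁻¹ * t * (r⁻¹ * k) = t := by
        rw [mul_assoc, ← mul_assoc t, hΛ (t * r⁻¹) (mul_mem ht (inv_mem hr)) k hk, mul_assoc r,
          inv_mul_cancel_left, hΛ t ht _ (inv_mem hr), mul_inv_cancel_left]
      have e2 : r * k⁻¹ * t * (t⁻¹ * k) = r := by group
      rw [mul_inv_cancel_left, e1] at h1
      rw [mul_inv_cancel_left, e2] at h2
      rw [hσ, ← h1, ← h2, mul_comm]
    · rfl
  change (e * a * e) * (e * p * e) = (e * p * e) * (e * a * e)
  calc (e * a * e) * (e * p * e) = e * (a * (e * e) * p) * e := by noncomm_ring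
    _ = e * (p * (e * e) * a) * e := by rw [hee, key]
    _ = _ := by noncomm_ring

theorem inner_lam_lam (g : Γ) (f f' : L2 Γ E) :
    inner ℂ (lam E g f) (lam E g f') = (inner ℂ f f' : ℂ) := by
  rw [← inner_star_apply, star_lam]
  congr 1
  ext k
  simp

theorem isToeplitz_star_mul_self {Λ : Subgroup Γ} (hΛ : ∀ r ∈ Λ, ∀ t ∈ Λ, r * t = t * r)
    {T : L2 Γ E →L[ℂ] L2 Γ E} (hT : ∀ z ∈ Λ, ∀ f, T (lam E z f) = lam E z (T f)) :
    IsToeplitz ξ Λ (star T * T) := fun r hr t ht z hz => by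
  have h : ∀ f f' : L2 Γ E, inner ℂ f ((star T * T) f') = (inner ℂ (T f) (T f') : ℂ) :=
    fun f f' => ContinuousLinearMap.adjoint_inner_right T f (T f')
  rw [h, h, hΛ r hr z hz, hΛ t ht z hz, ← lam_tens, ← lam_tens, hT z hz, hT z hz,
    inner_lam_lam]

/-- The bound that makes the conditional expectation well defined: for `T` commuting with `λ(Λ)`, the
compression of `T* T` to `ξ ⊗ ℓ²(Λ)` is Toeplitz, so it commutes with that of `x`. -/
theorem norm_apply_tensProj_le (hξ : ‖ξ‖ = 1) {Λ : Subgroup Γ}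
    (hΛ : ∀ r ∈ Λ, ∀ t ∈ Λ, r * t = t * r) {x : L2 Γ E →L[ℂ] L2 Γ E} (hx : IsToeplitz ξ Λ x)
    {T : L2 Γ E →L[ℂ] L2 Γ E} (hT : ∀ z ∈ Λ, ∀ f, T (lam E z f) = lam E z (T f)) :
    ‖T (tensProj ξ (Λ : Set Γ) (x (tens ξ 1)))‖ ≤ ‖x‖ * ‖T (tens ξ 1)‖ := by
  set e := tensProj ξ (Λ : Set Γ) with he
  set Ω : L2 Γ E := tens ξ 1
  have heΩ : e Ω = Ω := tensProj_tens_self hξ Λ.one_mem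
  have hes : star e = e := star_tensProj _ _
  have hee : ∀ f, e (e f) = e f := fun f => DFunLike.congr_fun (tensProj_mul_self hξ _) f
  have hcomm : Commute (star (T * e) * (T * e)) (e * x * e) := by
    have h := (hx.commute_compression hξ hΛ (isToeplitz_star_mul_self hΛ hT)).symm
    rw [star_mul, hes]
    convert h using 1
    noncomm_ring
  have hA : ‖e * x * e‖ ≤ ‖x‖ := ContinuousLinearMap.opNorm_le_bound _ (norm_nonneg _) fun f =>
    calc ‖e (x (e f))‖ ≤ ‖x (e f)‖ := norm_tensProj_apply_le hξ _ _
      _ ≤ ‖x‖ * ‖e f‖ := x.le_opNorm _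
      _ ≤ ‖x‖ * ‖f‖ := by gcongr; exact norm_tensProj_apply_le hξ _ _
  have h := norm_apply_le_of_commute hcomm Ω
  change ‖T (e (e (x (e Ω))))‖ ≤ _ * ‖T (e Ω)‖ at h
  rw [hee, heΩ] at h
  exact h.trans (by gcongr)

/-- The conditional expectation onto the von Neumann algebra generated by `λ(Λ)`, for an abelian
group `Λ`, evaluated at an operator `x` with Toeplitz compression. -/
theorem exists_condExp (hξ : ‖ξ‖ = 1) {Λ : Subgroup Γ}
    (hΛ : ∀ r ∈ Λ, ∀ t ∈ Λ, r * t = t * r) {x : L2 Γ E →L[ℂ] L2 Γ E} (hx : IsToeplitz ξ Λ x) :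
    ∃ c ∈ VonNeumannAlgebra.generatedBy (lam E '' (Λ : Set Γ)), ‖c‖ ≤ ‖x‖ ∧
      c (tens ξ 1) = tensProj ξ (Λ : Set Γ) (x (tens ξ 1)) := by
  -- `c` is first defined on `𝒯 (ξ ⊗ δ_1)`, for `𝒯` the commutant of `λ(Λ)`, by
  -- `c (T (ξ ⊗ δ_1)) = T (e x (ξ ⊗ δ_1))`; commuting with `𝒯` is then built in
  let 𝒯 : Submodule ℂ (L2 Γ E →L[ℂ] L2 Γ E) :=
    (Subalgebra.centralizer ℂ (lam E '' (Λ : Set Γ))).toSubmodule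
  have hmem : ∀ T, T ∈ 𝒯 ↔ ∀ z ∈ Λ, lam E z * T = T * lam E z := fun T => by
    change T ∈ Subalgebra.centralizer ℂ (lam E '' (Λ : Set Γ)) ↔ _
    rw [Subalgebra.mem_centralizer_iff]
    exact Set.forall_mem_image
  let ev : L2 Γ E → 𝒯 →ₗ[ℂ] L2 Γ E := fun f =>
    { toFun := fun T => (T : L2 Γ E →L[ℂ] L2 Γ E) f
      map_add' := fun _ _ => rfl
      map_smul' := fun _ _ => rfl }
  set η := tensProj ξ (Λ : Set Γ) (x (tens ξ 1)) with hη
  have hdense : DenseRange (ev (tens ξ 1)) := by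
    have h := topologicalClosure_eq_top_of_tens_mem (Γ := Γ) (D := (Set.univ : Set E))
      (S := LinearMap.range (ev (tens ξ 1))) dense_univ (by
        rintro w - g
        refine ⟨⟨ampl Γ (InnerProductSpace.rankOne ℂ w ξ) * rightTrans E g⁻¹,
          (hmem _).2 fun z _ => ?_⟩, ?_⟩
        · rw [← mul_assoc, lam_mul_ampl, mul_assoc, lam_mul_rightTrans, mul_assoc]
        · change ampl Γ (InnerProductSpace.rankOne ℂ w ξ) (rightTrans E g⁻¹ (tens ξ 1)) = _
          rw [rightTrans_tens, ampl_tens, InnerProductSpace.rankOne_apply,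
            inner_self_eq_norm_sq_to_K, hξ]
          simp)
    exact Submodule.dense_iff_topologicalClosure_eq_top.2 h
  have hbound : ∀ T : 𝒯, ‖ev η T‖ ≤ ‖x‖ * ‖ev (tens ξ 1) T‖ := fun T =>
    norm_apply_tensProj_le hξ hΛ hx fun z hz f =>
      (DFunLike.congr_fun ((hmem _).1 T.2 z hz) f).symm
  set c := LinearMap.extendOfNorm (ev η) (ev (tens ξ 1)) with hc
  have hcT : ∀ T : 𝒯, c (ev (tens ξ 1) T) = ev η T := fun T =>
    LinearMap.extendOfNorm_eq hdense ⟨‖x‖, hbound⟩ T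
  refine ⟨c, mem_generatedBy_iff.2 fun S hS => ?_, ?_, ?_⟩
  · have hS' : S ∈ 𝒯 := (hmem S).2 fun z hz => (hS _ ⟨z, hz, rfl⟩).1
    ext1 f
    refine hdense.induction_on (p := fun f => S (c f) = c (S f)) f
      (isClosed_eq (S.continuous.comp c.continuous) (c.continuous.comp S.continuous)) fun T => ?_
    have hST : S * T ∈ 𝒯 := (Subalgebra.centralizer ℂ (lam E '' (Λ : Set Γ))).mul_mem hS' T.2
    rw [hcT]
    exact (hcT ⟨S * T, hST⟩).symm
  · exact LinearMap.opNorm_extendOfNorm_le hdense (norm_nonneg _) hbound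
  · exact hcT ⟨1, (Subalgebra.centralizer ℂ (lam E '' (Λ : Set Γ))).one_mem⟩

end CondExp

/-! ### The GNS space of a trace -/

section GNS

variable {H : Type u} [NormedAddCommGroup H] [InnerProductSpace ℂ H] [CompleteSpace H]
  {M : VonNeumannAlgebra H} (τ : M →ₚ[ℂ] ℂ)

/-- The map `x ↦ x ξ_τ` from `M` to `L²(M, τ)`. -/
noncomputable def gnsVec : M →ₗ[ℂ] τ.GNS :=
  (UniformSpace.Completion.toComplL (𝕜 := ℂ) (E := τ.PreGNS)).toLinearMap ∘ₗ
    τ.toPreGNS.toLinearMap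

theorem gnsVec_def (x : M) : gnsVec τ x = ((τ.toPreGNS x : τ.PreGNS) : τ.GNS) := rfl

theorem gnsVec_one : gnsVec τ 1 = traceVector τ := rfl

theorem denseRange_gnsVec : DenseRange (gnsVec τ) :=
  UniformSpace.Completion.denseRange_coe.comp τ.toPreGNS.surjective.denseRange
    (UniformSpace.Completion.continuous_coe _)

theorem inner_gnsVec (x y : M) : inner ℂ (gnsVec τ x) (gnsVec τ y) = τ (star x * y) := by
  rw [gnsVec_def, gnsVec_def, UniformSpace.Completion.inner_coe]
  rfl

theorem gns_apply_gnsVec (a x : M) : τ.gnsStarAlgHom a (gnsVec τ x) = gnsVec τ (a * x) := by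
  rw [gnsVec_def, gnsVec_def]
  exact τ.gnsNonUnitalStarAlgHom_apply_coe

variable {τ}

theorem gnsVec_eq_zero (hτ : IsTrace M τ) {x : M} (h : gnsVec τ x = 0) : x = 0 :=
  hτ.faithful x (by rw [← inner_gnsVec, h, inner_zero_left])

theorem norm_gnsVec_star (hτ : IsTrace M τ) (x : M) : ‖gnsVec τ (star x)‖ = ‖gnsVec τ x‖ := by
  refine norm_eq_of_inner_self_eq ?_
  rw [inner_gnsVec, inner_gnsVec, hτ.map_mul_comm, star_star]

theorem norm_traceVector (hτ : IsTrace M τ) : ‖traceVector τ‖ = 1 := by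
  have h : inner ℂ (traceVector τ) (traceVector τ) = (1 : ℂ) := by
    rw [← gnsVec_one, inner_gnsVec, star_one, mul_one, hτ.map_one]
  rw [inner_self_eq_norm_sq_to_K] at h
  have h5 : ‖traceVector τ‖ ^ 2 = 1 := Complex.ofReal_injective (by simpa using h)
  exact (pow_eq_one_iff_of_nonneg (norm_nonneg _) two_ne_zero).1 h5

theorem norm_gnsVec_mul_le (hτ : IsTrace M τ) (a x : M) :
    ‖gnsVec τ (x * a)‖ ≤ ‖a‖ * ‖gnsVec τ x‖ := by
  rw [← norm_gnsVec_star hτ, star_mul, ← gns_apply_gnsVec, ← norm_gnsVec_star hτ x,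
    ← norm_star a]
  exact ContinuousLinearMap.le_of_opNorm_le _
    (NonUnitalStarAlgHom.norm_apply_le τ.gnsStarAlgHom _) _

variable (τ) in
/-- The operator of right multiplication by `a ∈ M` on `L²(M, τ)`, `x ξ_τ ↦ x a ξ_τ`, which is bounded
because `τ` is a trace. -/
noncomputable def rightMul (a : M) : τ.GNS →L[ℂ] τ.GNS :=
  LinearMap.extendOfNorm (gnsVec τ ∘ₗ LinearMap.mulRight ℂ a) (gnsVec τ)

theorem rightMul_gnsVec (hτ : IsTrace M τ) (a x : M) :
    rightMul τ a (gnsVec τ x) = gnsVec τ (x * a) :=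
  LinearMap.extendOfNorm_eq (denseRange_gnsVec τ) ⟨‖a‖, norm_gnsVec_mul_le hτ a⟩ x

theorem rightMul_gns_apply (hτ : IsTrace M τ) (a b : M) (w : τ.GNS) :
    rightMul τ a (τ.gnsStarAlgHom b w) = τ.gnsStarAlgHom b (rightMul τ a w) :=
  (denseRange_gnsVec τ).induction_on (p := fun w =>
      rightMul τ a (τ.gnsStarAlgHom b w) = τ.gnsStarAlgHom b (rightMul τ a w)) w
    (isClosed_eq ((rightMul τ a).continuous.comp (τ.gnsStarAlgHom b).continuous)
      ((τ.gnsStarAlgHom b).continuous.comp (rightMul τ a).continuous)) fun x => by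
      rw [gns_apply_gnsVec, rightMul_gnsVec hτ, rightMul_gnsVec hτ, gns_apply_gnsVec, mul_assoc]

theorem inner_traceVector_rightMul (hτ : IsTrace M τ) (a : M) (w : τ.GNS) :
    inner ℂ (traceVector τ) (rightMul τ a w) = (inner ℂ (gnsVec τ (star a)) w : ℂ) :=
  (denseRange_gnsVec τ).induction_on (p := fun w =>
      inner ℂ (traceVector τ) (rightMul τ a w) = (inner ℂ (gnsVec τ (star a)) w : ℂ)) w
    (isClosed_eq (continuous_const.inner (rightMul τ a).continuous)
      (continuous_const.inner continuous_id)) fun x => by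
      rw [rightMul_gnsVec hτ, ← gnsVec_one, inner_gnsVec, inner_gnsVec, star_one, one_mul,
        star_star, hτ.map_mul_comm]

variable {Γ : Type v} [Group Γ] {α : Γ →* (M ≃⋆ₐ[ℂ] M)}

theorem koopman_gnsVec (hα : PreservesTrace τ α) (g : Γ) (x : M) :
    koopman hα g (gnsVec τ x) = gnsVec τ (α g x) := by
  rw [gnsVec_def, gnsVec_def]
  unfold koopman
  rw [ContinuousLinearMap.completion_apply_coe]
  rfl

theorem koopman_traceVector (hα : PreservesTrace τ α) (g : Γ) : koopman hα g (traceVector τ) = traceVector τ := by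
  rw [← gnsVec_one, koopman_gnsVec, map_one]

theorem inner_koopman_koopman (hα : PreservesTrace τ α) (g : Γ) (w w' : τ.GNS) :
    inner ℂ (koopman hα g w) (koopman hα g w') = (inner ℂ w w' : ℂ) :=
  (denseRange_gnsVec τ).induction_on₂ (p := fun w w' =>
      inner ℂ (koopman hα g w) (koopman hα g w') = (inner ℂ w w' : ℂ))
    (isClosed_eq (((koopman hα g).continuous.comp continuous_fst).inner
      ((koopman hα g).continuous.comp continuous_snd)) (continuous_fst.inner continuous_snd)) (fun x y => by
      rw [koopman_gnsVec, koopman_gnsVec, inner_gnsVec, inner_gnsVec, ← map_star, ← map_mul,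
        hα]) w w'

theorem norm_koopman_apply (hα : PreservesTrace τ α) (g : Γ) (w : τ.GNS) : ‖koopman hα g w‖ = ‖w‖ :=
  norm_eq_of_inner_self_eq (inner_koopman_koopman hα g w w)

theorem inner_traceVector_koopman (hα : PreservesTrace τ α) (g : Γ) (w : τ.GNS) :
    inner ℂ (traceVector τ) (koopman hα g w) = (inner ℂ (traceVector τ) w : ℂ) := by
  conv_lhs => rw [← koopman_traceVector hα g]
  exact inner_koopman_koopman hα g _ _

theorem koopman_gns_apply (hα : PreservesTrace τ α) (g : Γ) (a : M) (w : τ.GNS) :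
    koopman hα g (τ.gnsStarAlgHom a w) = τ.gnsStarAlgHom (α g a) (koopman hα g w) :=
  (denseRange_gnsVec τ).induction_on (p := fun w =>
      koopman hα g (τ.gnsStarAlgHom a w) = τ.gnsStarAlgHom (α g a) (koopman hα g w)) w
    (isClosed_eq ((koopman hα g).continuous.comp (τ.gnsStarAlgHom a).continuous)
      ((τ.gnsStarAlgHom (α g a)).continuous.comp (koopman hα g).continuous)) fun x => by
      rw [gns_apply_gnsVec, koopman_gnsVec, koopman_gnsVec, gns_apply_gnsVec, map_mul]

/-! ### The crossed product and its commutant -/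

theorem cpVector_eq : cpVector τ Γ = tens (traceVector τ) 1 := rfl

theorem norm_cpVector (hτ : IsTrace M τ) : ‖cpVector τ Γ‖ = 1 := by
  rw [cpVector_eq, norm_tens, norm_traceVector hτ]

theorem embed_apply (x : M) (f : L2 Γ τ.GNS) (g : Γ) :
    embed τ α x f g = τ.gnsStarAlgHom (α g⁻¹ x) (f g) := rfl

theorem embed_tens (x : M) (w : τ.GNS) (g : Γ) :
    embed τ α x (tens w g) = tens (τ.gnsStarAlgHom (α g⁻¹ x) w) g :=
  diagOp_tens _ _ _ _

theorem star_embed (x : M) : star (embed τ α x) = embed τ α (star x) := by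
  unfold embed
  exact star_diagOp _ _ _ _ fun g => by rw [map_star, map_star]

theorem embed_mem (x : M) : embed τ α x ∈ crossedProduct τ α :=
  subset_generatedBy (Or.inl ⟨x, rfl⟩)

theorem lam_mem (g : Γ) : lam τ.GNS g ∈ crossedProduct τ α :=
  subset_generatedBy (Or.inr ⟨g, rfl⟩)

theorem commute_of_commute_generators {T : L2 Γ τ.GNS →L[ℂ] L2 Γ τ.GNS}
    (hM : ∀ x, embed τ α x * T = T * embed τ α x)
    (hΓ : ∀ g, lam τ.GNS g * T = T * lam τ.GNS g) {y : L2 Γ τ.GNS →L[ℂ] L2 Γ τ.GNS}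
    (hy : y ∈ crossedProduct τ α) (f : L2 Γ τ.GNS) : y (T f) = T (y f) := by
  refine (DFunLike.congr_fun (mem_generatedBy_iff.1 hy T ?_) f).symm
  rintro _ (⟨x, rfl⟩ | ⟨g, rfl⟩)
  · rw [star_embed]
    exact ⟨hM x, hM _⟩
  · rw [star_lam]
    exact ⟨hΓ g, hΓ _⟩

/-- The right translation `(ζ λ(g)⁻¹)(h) = α_g(ζ(h g))`, a unitary in the commutant of the crossed
product. -/
noncomputable def rightShift (hα : PreservesTrace τ α) (g : Γ) : L2 Γ τ.GNS →L[ℂ] L2 Γ τ.GNS :=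
  ampl Γ (koopman hα g) * rightTrans τ.GNS g

theorem rightShift_apply (hα : PreservesTrace τ α) (g : Γ) (f : L2 Γ τ.GNS) (h : Γ) :
    rightShift hα g f h = koopman hα g (f (h * g)) := rfl

theorem rightShift_tens_traceVector (hα : PreservesTrace τ α) (g h : Γ) :
    rightShift hα g (tens (traceVector τ) h) = tens (traceVector τ) (h * g⁻¹) := by
  change ampl Γ (koopman hα g) (rightTrans τ.GNS g _) = _
  rw [rightTrans_tens, ampl_tens, koopman_traceVector]

theorem crossedProduct_apply_rightShift (hα : PreservesTrace τ α)
    {y : L2 Γ τ.GNS →L[ℂ] L2 Γ τ.GNS}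
    (hy : y ∈ crossedProduct τ α) (g : Γ) (f : L2 Γ τ.GNS) :
    y (rightShift hα g f) = rightShift hα g (y f) := by
  refine commute_of_commute_generators (fun x => ?_) (fun k => ?_) hy f
  · ext f h
    change embed τ α x (rightShift hα g f) h = rightShift hα g (embed τ α x f) h
    have e : α g (α (h * g)⁻¹ x) = α h⁻¹ x := by
      change (α g * α (h * g)⁻¹) x = _
      rw [← map_mul, mul_inv_rev, mul_inv_cancel_left]
    rw [rightShift_apply, embed_apply, rightShift_apply, embed_apply, koopman_gns_apply, e]
  · ext f h
    change rightShift hα g f (k⁻¹ * h) = koopman hα g (f (k⁻¹ * (h * g)))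
    rw [rightShift_apply, mul_assoc]

theorem crossedProduct_apply_rightMul (hτ : IsTrace M τ) {y : L2 Γ τ.GNS →L[ℂ] L2 Γ τ.GNS}
    (hy : y ∈ crossedProduct τ α) (a : M) (f : L2 Γ τ.GNS) :
    y (ampl Γ (rightMul τ a) f) = ampl Γ (rightMul τ a) (y f) := by
  refine commute_of_commute_generators (fun x => ?_) (fun k => ?_) hy f
  · ext f h
    exact (rightMul_gns_apply hτ _ _ _).symm
  · ext f h
    rfl

theorem rightMul_rightShift_cpVector (hα : PreservesTrace τ α)
    (hτ : IsTrace M τ) (a : M) (g : Γ) :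
    ampl Γ (rightMul τ a) (rightShift hα g (cpVector τ Γ)) = tens (gnsVec τ a) g⁻¹ := by
  rw [cpVector_eq, rightShift_tens_traceVector, ampl_tens, ← gnsVec_one, rightMul_gnsVec hτ,
    one_mul, one_mul]

theorem embed_cpVector (hτ : IsTrace M τ) (a : M) :
    embed τ α a (cpVector τ Γ) = ampl Γ (rightMul τ a) (cpVector τ Γ) := by
  have h : α 1⁻¹ a = a := by
    rw [inv_one, map_one]
    rfl
  rw [cpVector_eq, embed_tens, ampl_tens, ← gnsVec_one, rightMul_gnsVec hτ, gns_apply_gnsVec, h,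
    mul_one, one_mul]

theorem commutator_embed_apply_cpVector (hτ : IsTrace M τ)
    {y : L2 Γ τ.GNS →L[ℂ] L2 Γ τ.GNS} (hy : y ∈ crossedProduct τ α) (a : M) {z : Γ} {c : ℂ}
    (hc : y (cpVector τ Γ) z = c • traceVector τ) :
    (y * embed τ α a - embed τ α a * y) (cpVector τ Γ) z = c • gnsVec τ (a - α z⁻¹ a) := by
  have h1 : y (embed τ α a (cpVector τ Γ)) z = c • gnsVec τ a := by
    rw [embed_cpVector hτ, crossedProduct_apply_rightMul hτ hy, ampl_apply, hc, map_smul,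
      ← gnsVec_one, rightMul_gnsVec hτ, one_mul]
  have h2 : embed τ α a (y (cpVector τ Γ)) z = c • gnsVec τ (α z⁻¹ a) := by
    rw [embed_apply, hc, map_smul, ← gnsVec_one, gns_apply_gnsVec, mul_one]
  rw [map_sub, smul_sub, ← h1, ← h2]
  rfl

/-- `ξ_τ ⊗ δ_1` is a separating vector, as it is cyclic for the commutant. -/
theorem eq_zero_of_apply_cpVector_eq_zero (hα : PreservesTrace τ α)
    (hτ : IsTrace M τ) {y : L2 Γ τ.GNS →L[ℂ] L2 Γ τ.GNS}
    (hy : y ∈ crossedProduct τ α) (h : y (cpVector τ Γ) = 0) : y = 0 := by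
  have hD := topologicalClosure_eq_top_of_tens_mem (Γ := Γ) (S := LinearMap.ker y.toLinearMap)
    (denseRange_gnsVec τ) (by
      rintro _ ⟨a, rfl⟩ g
      rw [← inv_inv g, ← rightMul_rightShift_cpVector hα hτ]
      change y _ = 0
      rw [crossedProduct_apply_rightMul hτ hy, crossedProduct_apply_rightShift hα hy, h,
        map_zero, map_zero])
  have hc : IsClosed (LinearMap.ker y.toLinearMap : Set (L2 Γ τ.GNS)) := y.isClosed_ker
  rw [hc.submodule_topologicalClosure_eq] at hD
  ext1 f
  exact (hD ▸ Submodule.mem_top : f ∈ LinearMap.ker y.toLinearMap)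

/-- The adjoint reverses coordinates, up to an isometry of the coefficient space. -/
theorem norm_star_apply_cpVector_coord_le (hα : PreservesTrace τ α)
    (hτ : IsTrace M τ)
    {y : L2 Γ τ.GNS →L[ℂ] L2 Γ τ.GNS} (hy : y ∈ crossedProduct τ α) (g : Γ) :
    ‖star y (cpVector τ Γ) g⁻¹‖ ≤ ‖y (cpVector τ Γ) g‖ := by
  set w := star y (cpVector τ Γ) g⁻¹ with hw
  -- by duality against the dense set of vectors `a ξ_τ`
  have key : ∀ a : M, ‖(inner ℂ w (gnsVec τ a) : ℂ)‖ ≤ ‖y (cpVector τ Γ) g‖ * ‖gnsVec τ a‖ := by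
    intro a
    rw [hw, ← inner_tens_right, ← rightMul_rightShift_cpVector hα hτ, inner_star_apply,
      crossedProduct_apply_rightMul hτ hy, crossedProduct_apply_rightShift hα hy, cpVector_eq,
      inner_tens_left, ampl_apply, inner_traceVector_rightMul hτ, rightShift_apply, one_mul]
    refine (norm_inner_le_norm _ _).trans ?_
    rw [norm_gnsVec_star hτ, norm_koopman_apply, mul_comm]
  have key' : ∀ v : τ.GNS, ‖(inner ℂ w v : ℂ)‖ ≤ ‖y (cpVector τ Γ) g‖ * ‖v‖ := fun v =>
    (denseRange_gnsVec τ).induction_on (p := fun v =>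
      ‖(inner ℂ w v : ℂ)‖ ≤ ‖y (cpVector τ Γ) g‖ * ‖v‖) v
      (isClosed_le
        (continuous_const.inner continuous_id).norm
        (continuous_const.mul continuous_norm)) key
  have h := key' w
  rw [inner_self_eq_norm_sq_to_K, norm_pow, RCLike.norm_ofReal, abs_norm, sq] at h
  rcases (norm_nonneg w).eq_or_lt with h0 | h0
  · rw [← h0]
    exact norm_nonneg _
  · exact le_of_mul_le_mul_right h h0

theorem norm_star_apply_cpVector_le (hα : PreservesTrace τ α)
    (hτ : IsTrace M τ)
    {y : L2 Γ τ.GNS →L[ℂ] L2 Γ τ.GNS} (hy : y ∈ crossedProduct τ α) :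
    ‖star y (cpVector τ Γ)‖ ≤ ‖y (cpVector τ Γ)‖ :=
  norm_le_of_norm_inv_le (norm_star_apply_cpVector_coord_le hα hτ hy)

/-- The vector state of `ξ_τ ⊗ δ_1` is a trace on the crossed product. -/
theorem norm_star_apply_cpVector (hα : PreservesTrace τ α)
    (hτ : IsTrace M τ)
    {y : L2 Γ τ.GNS →L[ℂ] L2 Γ τ.GNS} (hy : y ∈ crossedProduct τ α) :
    ‖star y (cpVector τ Γ)‖ = ‖y (cpVector τ Γ)‖ := by
  refine le_antisymm (norm_star_apply_cpVector_le hα hτ hy) ?_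
  simpa only [star_star] using norm_star_apply_cpVector_le hα hτ (star_mem hy)

end GNS

/-! ### Central sequences of the crossed product -/

section CentralSequences

variable {H : Type u} [NormedAddCommGroup H] [InnerProductSpace ℂ H] [CompleteSpace H]
  {M : VonNeumannAlgebra H} {τ : M →ₚ[ℂ] ℂ} {Γ : Type v} [Group Γ] {α : Γ →* (M ≃⋆ₐ[ℂ] M)}

theorem inner_rightShift_rightShift (hα : PreservesTrace τ α) (g : Γ) (f f' : L2 Γ τ.GNS) :
    inner ℂ (rightShift hα g f) (rightShift hα g f') = (inner ℂ f f' : ℂ) := by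
  rw [lp.inner_eq_tsum, lp.inner_eq_tsum,
    ← (Equiv.mulRight g).tsum_eq fun k => inner ℂ (f k) (f' k)]
  exact tsum_congr fun k => inner_koopman_koopman hα g _ _

theorem isToeplitz_of_mem (hα : PreservesTrace τ α) (Λ : Subgroup Γ)
    {y : L2 Γ τ.GNS →L[ℂ] L2 Γ τ.GNS} (hy : y ∈ crossedProduct τ α) :
    IsToeplitz (traceVector τ) Λ y :=
  IsToeplitz.of_isometry (fun z f => rightShift hα z⁻¹ f)
    (fun z f f' => inner_rightShift_rightShift hα z⁻¹ f f')
    (fun z _ t _ => by rw [rightShift_tens_traceVector, inv_inv])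
    (fun z _ f => crossedProduct_apply_rightShift hα hy z⁻¹ f)

theorem groupAlgebra_le (Λ : Subgroup Γ) {y : L2 Γ τ.GNS →L[ℂ] L2 Γ τ.GNS}
    (hy : y ∈ groupAlgebra τ Λ) : y ∈ crossedProduct τ α :=
  mem_generatedBy_iff.2 fun T hT => mem_generatedBy_iff.1 hy T fun s ⟨g, _, hg⟩ =>
    hT s (Or.inr ⟨g, hg⟩)

theorem lam_cpVector (hα : PreservesTrace τ α) (g : Γ) :
    lam τ.GNS g⁻¹ (cpVector τ Γ) = rightShift hα g (cpVector τ Γ) := by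
  rw [cpVector_eq, lam_tens, rightShift_tens_traceVector, mul_one, one_mul]

theorem fourierCoeff_eq (hα : PreservesTrace τ α) {y : L2 Γ τ.GNS →L[ℂ] L2 Γ τ.GNS}
    (hy : y ∈ crossedProduct τ α) (g : Γ) :
    fourierCoeff τ y g = inner ℂ (traceVector τ) (y (cpVector τ Γ) g) := by
  change inner ℂ (cpVector τ Γ) (y (lam τ.GNS g⁻¹ (cpVector τ Γ))) = _
  rw [lam_cpVector hα, crossedProduct_apply_rightShift hα hy]
  nth_rewrite 1 [cpVector_eq]
  rw [inner_tens_left, rightShift_apply, inner_traceVector_koopman, one_mul]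

theorem lam_rightShift_apply (hα : PreservesTrace τ α) (g : Γ) (f : L2 Γ τ.GNS) (k : Γ) :
    lam τ.GNS g (rightShift hα g f) k = koopman hα g (f (g⁻¹ * k * g)) := rfl

/-- Asymptotic commutation with `λ(g)` says that `x_n Ω` is asymptotically invariant under the
conjugation `ζ ↦ λ(g) ζ λ(g)⁻¹`. -/
theorem IsCentralSeq.tendsto_conj (hα : PreservesTrace τ α)
    {x : ℕ → L2 Γ τ.GNS →L[ℂ] L2 Γ τ.GNS}
    (hx : IsCentralSeq (crossedProduct τ α) (cpVector τ Γ) x) (g : Γ) :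
    Tendsto (fun n => ‖lam τ.GNS g (rightShift hα g (x n (cpVector τ Γ))) - x n (cpVector τ Γ)‖)
      atTop (𝓝 0) := by
  refine (hx.central (lam τ.GNS g⁻¹) (lam_mem g⁻¹)).congr fun n => ?_
  have h : x n (cpVector τ Γ) = lam τ.GNS g (lam τ.GNS g⁻¹ (x n (cpVector τ Γ))) := by
    ext k
    simp
  nth_rewrite 2 [h]
  rw [← map_sub, norm_lam_apply, ← crossedProduct_apply_rightShift hα (hx.mem n),
    ← lam_cpVector hα]
  rfl

/-- The distance to `ξ_τ ⊗ ℓ²(Z)`, for `Z` the center of `Γ`, is controlled by the mass off `Z` and,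
on `Z`, by the spectral gap of the action. -/
theorem norm_sub_tensProj_sq_le (hα : PreservesTrace τ α) {F : Finset Γ} {C : ℝ} (hC : 0 ≤ C)
    (hgap : ∀ w : τ.GNS, ‖w - (inner ℂ (traceVector τ) w : ℂ) • traceVector τ‖ ^ 2 ≤
      C * ∑ g ∈ F, ‖koopman hα g w - w‖ ^ 2) (f : L2 Γ τ.GNS) :
    ‖f - tensProj (traceVector τ) (Subgroup.center Γ : Set Γ) f‖ ^ 2 ≤
      ‖restr τ.GNS (Subgroup.center Γ : Set Γ)ᶜ f‖ ^ 2 +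
        C * ∑ g ∈ F, ‖lam τ.GNS g (rightShift hα g f) - f‖ ^ 2 := by
  classical
  set Z : Set Γ := (Subgroup.center Γ : Set Γ) with hZ
  rw [norm_add_norm_restr_compl_sq Z, add_comm]
  refine add_le_add (le_of_eq ?_) ?_
  · congr 2
    ext k
    rw [restr_apply, restr_apply, lp.coeFn_sub, Pi.sub_apply, tensProj_apply]
    by_cases hk : k ∈ Z <;> simp [hk]
  · rw [norm_restr_sq]
    have hs : HasSum (fun k => C * ∑ g ∈ F, ‖(lam τ.GNS g (rightShift hα g f) - f) k‖ ^ 2)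
        (C * ∑ g ∈ F, ‖lam τ.GNS g (rightShift hα g f) - f‖ ^ 2) := by
      refine (hasSum_sum fun g _ => ?_).mul_left C
      rw [norm_sq_eq_tsum]
      exact (summable_norm_sq _).hasSum
    have hle : ∀ k, (if k ∈ Z then ‖(f - tensProj (traceVector τ) Z f) k‖ ^ 2 else 0) ≤
        C * ∑ g ∈ F, ‖(lam τ.GNS g (rightShift hα g f) - f) k‖ ^ 2 := fun k => by
      split_ifs with hk
      · have hc : ∀ g : Γ, g⁻¹ * k * g = k := fun g => by
          rw [mul_assoc, ← Subgroup.mem_center_iff.1 hk g, inv_mul_cancel_left]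
        rw [lp.coeFn_sub, Pi.sub_apply, tensProj_apply, if_pos hk]
        refine (hgap (f k)).trans (le_of_eq ?_)
        congr 1
        refine Finset.sum_congr rfl fun g _ => ?_
        rw [lp.coeFn_sub, Pi.sub_apply, lam_rightShift_apply, hc]
      · exact mul_nonneg hC (Finset.sum_nonneg fun _ _ => sq_nonneg _)
    rw [← hs.tsum_eq]
    exact Summable.tsum_le_tsum hle (hs.summable.of_nonneg_of_le
      (fun k => by split_ifs <;> positivity) hle) hs.summable

theorem IsCentralSeq.tendsto_norm_sub_tensProj [Countable Γ] (hτ : IsTrace M τ)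
    (hα : PreservesTrace τ α) (herg : IsSStronglyErgodic hα)
    (hinner : ¬ IsInnerAmenable (Γ ⧸ Subgroup.center Γ))
    {x : ℕ → L2 Γ τ.GNS →L[ℂ] L2 Γ τ.GNS}
    (hx : IsCentralSeq (crossedProduct τ α) (cpVector τ Γ) x) :
    Tendsto (fun n => ‖x n (cpVector τ Γ) - tensProj (traceVector τ) (Subgroup.center Γ : Set Γ)
      (x n (cpVector τ Γ))‖) atTop (𝓝 0) := by
  obtain ⟨F, C, hC, hgap⟩ := exists_spectral_gap (norm_traceVector hτ) (koopman hα)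
    (koopman_traceVector hα) herg
  obtain ⟨D, hD⟩ := hx.bounded
  have hoff := tendsto_norm_restr_compl (Subgroup.center Γ) hinner
    (f := fun n => x n (cpVector τ Γ)) (C := D) (fun n => by
      have := (x n).le_of_opNorm_le (hD n) (cpVector τ Γ)
      rwa [norm_cpVector hτ, mul_one] at this)
    (fun g => ⟨fun n => lam τ.GNS g (rightShift hα g (x n (cpVector τ Γ))), fun n k => by
      rw [lam_rightShift_apply, norm_koopman_apply], hx.tendsto_conj hα g⟩)
  have hon : Tendsto (fun n => C * ∑ g ∈ F,
      ‖lam τ.GNS g (rightShift hα g (x n (cpVector τ Γ))) - x n (cpVector τ Γ)‖ ^ 2)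
      atTop (𝓝 0) := by
    have := (tendsto_finsetSum F fun g _ => (hx.tendsto_conj hα g).pow 2).const_mul C
    simpa using this
  have hsq := squeeze_zero (fun n => sq_nonneg _)
    (fun n => norm_sub_tensProj_sq_le hα hC hgap (x n (cpVector τ Γ)))
    (by simpa using hoff.add hon)
  simpa only [Real.sqrt_sq (norm_nonneg _), Real.sqrt_zero] using hsq.sqrt

/-- Asymptotic commutation with `M` kills the coefficient at `z` as soon as `α_z` is not the
identity. -/
theorem IsCentralSeq.tendsto_coeff (hτ : IsTrace M τ) (hfree : IsFreeAction α)
    {c : ℕ → L2 Γ τ.GNS →L[ℂ] L2 Γ τ.GNS}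
    (hc : IsCentralSeq (crossedProduct τ α) (cpVector τ Γ) c) {A : Set Γ}
    (hcA : ∀ n, ∃ f, c n (cpVector τ Γ) = tensProj (traceVector τ) A f) {z : Γ} (hz : z ≠ 1) :
    Tendsto (fun n => ‖(inner ℂ (traceVector τ) (c n (cpVector τ Γ) z) : ℂ)‖) atTop (𝓝 0) := by
  obtain ⟨a, ha⟩ : ∃ a : M, a - α z⁻¹ a ≠ 0 := by
    by_contra! hcon
    -- otherwise `α_{z⁻¹}` is the identity and `1` intertwines it with itself
    have h10 : (1 : M) = 0 := hfree z⁻¹ (inv_ne_one.2 hz) 1 fun x => by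
      rw [one_mul, mul_one]
      exact sub_eq_zero.1 (hcon x)
    have := hτ.map_one
    rw [h10, map_zero] at this
    exact zero_ne_one this
  have hpos : 0 < ‖gnsVec τ (a - α z⁻¹ a)‖ :=
    norm_pos_iff.2 fun h => ha (gnsVec_eq_zero hτ h)
  have hlim : Tendsto (fun n => norm2 (cpVector τ Γ) (c n * embed τ α a - embed τ α a * c n) /
      ‖gnsVec τ (a - α z⁻¹ a)‖) atTop (𝓝 0) := by
    simpa using (hc.central _ (embed_mem a)).div_const ‖gnsVec τ (a - α z⁻¹ a)‖
  refine squeeze_zero (fun n => norm_nonneg _) (fun n => ?_) hlim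
  have hcz : c n (cpVector τ Γ) z =
      (inner ℂ (traceVector τ) (c n (cpVector τ Γ) z) : ℂ) • traceVector τ := by
    obtain ⟨f, hf⟩ := hcA n
    rw [hf]
    exact tensProj_apply_eq_smul (norm_traceVector hτ) A f z
  rw [le_div_iff₀ hpos, ← norm_smul, ← commutator_embed_apply_cpVector hτ (hc.mem n) a hcz]
  exact norm_coord_le _ z

/-- Every central sequence is equivalent to its conditional expectation onto `L(Z)`, whose
coefficients away from `1` tend to zero. -/
theorem IsCentralSeq.exists_equiv [Countable Γ] (hτ : IsTrace M τ)
    (hα : PreservesTrace τ α) (herg : IsSStronglyErgodic hα) (hfree : IsFreeAction α)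
    (hinner : ¬ IsInnerAmenable (Γ ⧸ Subgroup.center Γ))
    {x : ℕ → L2 Γ τ.GNS →L[ℂ] L2 Γ τ.GNS}
    (hx : IsCentralSeq (crossedProduct τ α) (cpVector τ Γ) x) :
    ∃ c : ℕ → L2 Γ τ.GNS →L[ℂ] L2 Γ τ.GNS,
      IsCentralSeq (crossedProduct τ α) (cpVector τ Γ) c ∧ SeqEquiv (cpVector τ Γ) x c ∧
      (∀ n, c n ∈ groupAlgebra τ (Subgroup.center Γ)) ∧
      (∀ n, c n (cpVector τ Γ) = tensProj (traceVector τ) (Subgroup.center Γ : Set Γ)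
        (x n (cpVector τ Γ))) ∧
      ∀ z : Γ, z ≠ 1 →
        Tendsto (fun n => ‖(inner ℂ (traceVector τ) (c n (cpVector τ Γ) z) : ℂ)‖) atTop (𝓝 0) := by
  choose c hcmem hcnorm hcΩ using fun n => exists_condExp (norm_traceVector hτ)
    (Λ := Subgroup.center Γ) (fun r _ t ht => Subgroup.mem_center_iff.1 ht r)
    (isToeplitz_of_mem hα (Subgroup.center Γ) (hx.mem n))
  have hequiv : SeqEquiv (cpVector τ Γ) x c := by
    refine (hx.tendsto_norm_sub_tensProj hτ hα herg hinner).congr fun n => ?_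
    exact congrArg (fun v => ‖x n (cpVector τ Γ) - v‖) (hcΩ n).symm
  obtain ⟨C, hC⟩ := hx.bounded
  have hcent : IsCentralSeq (crossedProduct τ α) (cpVector τ Γ) c :=
    hx.congr (fun y hy => norm_star_apply_cpVector hα hτ hy)
      (fun n => groupAlgebra_le _ (hcmem n)) ⟨C, fun n => (hcnorm n).trans (hC n)⟩ hequiv
  exact ⟨c, hcent, hequiv, hcmem, hcΩ, fun z hz =>
    hcent.tendsto_coeff hτ hfree (fun n => ⟨_, hcΩ n⟩) hz⟩

/-! ### Factoriality and fullness -/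

theorem exists_eq_smul_one_of_central [Countable Γ] (hτ : IsTrace M τ)
    (hα : PreservesTrace τ α) (herg : IsSStronglyErgodic hα) (hfree : IsFreeAction α)
    (hinner : ¬ IsInnerAmenable (Γ ⧸ Subgroup.center Γ))
    {x : L2 Γ τ.GNS →L[ℂ] L2 Γ τ.GNS} (hx : x ∈ crossedProduct τ α)
    (hcomm : ∀ y ∈ crossedProduct τ α, x * y = y * x) :
    ∃ c : ℂ, x = c • (1 : L2 Γ τ.GNS →L[ℂ] L2 Γ τ.GNS) := by
  classical
  have hcent : IsCentralSeq (crossedProduct τ α) (cpVector τ Γ) fun _ => x :=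
    { mem := fun _ => hx
      bounded := ⟨‖x‖, fun _ => le_rfl⟩
      central := fun y hy => by
        rw [hcomm y hy, sub_self]
        simp [norm2] }
  have hfix := hcent.tendsto_norm_sub_tensProj hτ hα herg hinner
  have hx1 := sub_eq_zero.1 (norm_eq_zero.1 (tendsto_nhds_unique tendsto_const_nhds hfix))
  have hcoef : ∀ z : Γ, z ≠ 1 → inner ℂ (traceVector τ) (x (cpVector τ Γ) z) = (0 : ℂ) :=
    fun z hz => norm_eq_zero.1 (tendsto_nhds_unique tendsto_const_nhds
      (hcent.tendsto_coeff hτ hfree (fun _ => ⟨_, hx1⟩) hz))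
  refine ⟨inner ℂ (traceVector τ) (x (cpVector τ Γ) 1), ?_⟩
  refine sub_eq_zero.1 (eq_zero_of_apply_cpVector_eq_zero hα hτ
    (sub_mem hx (SMulMemClass.smul_mem _ (one_mem _))) ?_)
  exact sub_eq_zero.2 (eq_smul_tens_of_inner_eq_zero (norm_traceVector hτ) hx1 1 hcoef)

theorem not_finiteDimensional_crossedProduct (hτ : IsTrace M τ)
    (hΓ : Nontrivial (Γ ⧸ Subgroup.center Γ))
    (hinner : ¬ IsInnerAmenable (Γ ⧸ Subgroup.center Γ)) :
    ¬ FiniteDimensional ℂ (crossedProduct τ α) := by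
  intro hfd
  let ev : crossedProduct τ α →ₗ[ℂ] L2 Γ τ.GNS :=
    { toFun := fun y => (y : L2 Γ τ.GNS →L[ℂ] L2 Γ τ.GNS) (cpVector τ Γ)
      map_add' := fun _ _ => rfl
      map_smul' := fun _ _ => rfl }
  have hon : Orthonormal ℂ fun g : Γ => tens (traceVector τ) g := by
    classical
    rw [orthonormal_iff_ite]
    intro g h
    rw [inner_tens_left, tens_apply]
    split_ifs
    · rw [inner_self_eq_norm_sq_to_K, norm_traceVector hτ]
      simp
    · exact inner_zero_right _
  have hli : LinearIndependent ℂ fun g : Γ => (⟨lam τ.GNS g, lam_mem g⟩ : crossedProduct τ α) := by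
    have h : (ev ∘ fun g : Γ => (⟨lam τ.GNS g, lam_mem g⟩ : crossedProduct τ α)) =
        fun g : Γ => tens (traceVector τ) g := by
      funext g
      change lam τ.GNS g (cpVector τ Γ) = _
      rw [cpVector_eq, lam_tens, mul_one]
    refine LinearIndependent.of_comp ev ?_
    rw [h]
    exact hon.linearIndependent
  have : Finite Γ := hli.finite
  exact hinner (isInnerAmenable_of_finite _)

theorem isFull_of_finite_center [Countable Γ] (hτ : IsTrace M τ)
    (hα : PreservesTrace τ α) (herg : IsSStronglyErgodic hα) (hfree : IsFreeAction α)
    (hinner : ¬ IsInnerAmenable (Γ ⧸ Subgroup.center Γ)) (hZ : Finite (Subgroup.center Γ)) :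
    IsFull (crossedProduct τ α) (cpVector τ Γ) := by
  classical
  intro x hx
  obtain ⟨c, -, hxc, -, hcΩ, hcoef⟩ := hx.exists_equiv hτ hα herg hfree hinner
  set Ω := cpVector τ Γ with hΩ
  have hfin : ((Subgroup.center Γ : Set Γ) \ {1}).Finite :=
    (Set.toFinite (Subgroup.center Γ : Set Γ)).subset Set.sdiff_subset
  have hlim : Tendsto (fun n => 2 * norm2 Ω (x n - c n) +
      ∑ z ∈ hfin.toFinset, ‖(inner ℂ (traceVector τ) (c n Ω z) : ℂ)‖) atTop (𝓝 0) := by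
    have h2 := tendsto_finsetSum hfin.toFinset fun z hz =>
      hcoef z ((Set.Finite.mem_toFinset hfin).1 hz).2
    simpa using (hxc.const_mul 2).add h2
  refine squeeze_zero (fun n => norm2_nonneg _) (fun n => ?_) hlim
  refine (norm_sub_inner_smul_le (norm_cpVector hτ) (x n Ω) (c n Ω)).trans
    (add_le_add le_rfl ?_)
  have h := norm_sub_smul_tens_le (norm_traceVector hτ) (hcΩ n) 1 (K := hfin.toFinset)
    fun k => Set.Finite.mem_toFinset hfin
  rwa [← inner_tens_left] at h

end CentralSequences

end VNCrossed

theorem lemma2p2 {H : Type u} [NormedAddCommGroup H] [InnerProductSpace ℂ H] [CompleteSpace H]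
    (M : VonNeumannAlgebra H) (τ : M →ₚ[ℂ] ℂ) (hτ : VNCrossed.IsTrace M τ)
    {Γ : Type v} [Group Γ] [Countable Γ] (α : Γ →* (M ≃⋆ₐ[ℂ] M))
    (hα : VNCrossed.PreservesTrace τ α)
    (herg : VNCrossed.IsSStronglyErgodic hα)
    (hfree : VNCrossed.IsFreeAction α)
    (hnontriv : Nontrivial (Γ ⧸ Subgroup.center Γ))
    (hinner : ¬ VNCrossed.IsInnerAmenable (Γ ⧸ Subgroup.center Γ)) :
    VNCrossed.IsTypeIIOneFactor (VNCrossed.crossedProduct τ α) ∧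
    (∀ x : ℕ → VNCrossed.L2 Γ τ.GNS →L[ℂ] VNCrossed.L2 Γ τ.GNS,
      VNCrossed.IsCentralSeq (VNCrossed.crossedProduct τ α) (VNCrossed.cpVector τ Γ) x →
      ∃ c : ℕ → VNCrossed.L2 Γ τ.GNS →L[ℂ] VNCrossed.L2 Γ τ.GNS,
        VNCrossed.IsCentralSeq (VNCrossed.crossedProduct τ α) (VNCrossed.cpVector τ Γ) c ∧
        VNCrossed.SeqEquiv (VNCrossed.cpVector τ Γ) x c ∧
        (∀ n, c n ∈ VNCrossed.groupAlgebra τ (Subgroup.center Γ)) ∧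
        ∀ K : Finset Γ, (K : Set Γ) ⊆ (Subgroup.center Γ : Set Γ) \ {1} →
          Tendsto (fun n => ∑ z ∈ K, ‖VNCrossed.fourierCoeff τ (c n) z‖ ^ 2) atTop (𝓝 0)) ∧
    (Finite (Subgroup.center Γ) →
      VNCrossed.IsFull (VNCrossed.crossedProduct τ α) (VNCrossed.cpVector τ Γ)) := by
  refine ⟨⟨fun x hx hcomm => VNCrossed.exists_eq_smul_one_of_central hτ hα herg hfree hinner hx
      hcomm, fun w hw h => VNCrossed.mul_star_eq_one_of_tracial (VNCrossed.norm_cpVector hτ)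
      (fun y hy => VNCrossed.norm_star_apply_cpVector hα hτ hy)
      (fun y hy => VNCrossed.eq_zero_of_apply_cpVector_eq_zero hα hτ hy) hw h,
      VNCrossed.not_finiteDimensional_crossedProduct hτ hnontriv hinner⟩, fun x hx => ?_,
    fun hZ => VNCrossed.isFull_of_finite_center hτ hα herg hfree hinner hZ⟩
  obtain ⟨c, hc, hxc, hcZ, -, hcoef⟩ := hx.exists_equiv hτ hα herg hfree hinner
  refine ⟨c, hc, hxc, hcZ, fun K hK => ?_⟩
  have h := tendsto_finsetSum K fun z hz => (hcoef z (hK hz).2).pow 2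
  simp only [VNCrossed.fourierCoeff_eq hα (hc.mem _)]
  simpa using h
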